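/- A represented space is a set $X$ with a partial surjection $\delta_X:\subseteq\mathbb{N}^{\mathbb{N}}\to X$; if $\delta_X(p)=x$, then $p$ is a name of $x$. A realizer of a multivalued function $f:\subseteq X\rightrightarrows Y$ between represented spaces is a partial function $G:\subseteq\mathbb{N}^{\mathbb{N}}\to\mathbb{N}^{\mathbb{N}}$ that maps each name of each $x\in\operatorname{dom}(f)$ to a name of some element of $f(x)$, and $f$ is computable if it has a computable realizer. We write $f\leq_{\mathrm W}g$ ($f$ is Weihrauch reducible to $g$) if there are computable $K,H:\subseteq\mathbb{N}^{\mathbb{N}}\to\mathbb{N}^{\mathbb{N}}$ such that $p\mapsto K\langle p,G(H(p))\rangle$ is a realizer of $f$ for every realizer $G$ of $g$. The product is $(f\times g)(x,y)=f(x)\times g(y)$, and the parallelization $\widehat f$ maps a sequence $(x_i)_{i\in\mathbb{N}}$ to the sequences $(y_i)_{i\in\mathbb{N}}$ with $y_i\in f(x_i)$ for all $i$. All games have two players, $a$ and $b$, who produce a play $x\in\{0,1\}^{\mathbb{N}}$ bit by bit; a function $d:\{0,1\}^*\to\{a,b\}$ says whose turn it is after each finite history. A strategy profile is a function $\sigma:\{0,1\}^*\to\{0,1\}$.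 It is a Nash equilibrium if no player can obtain an outcome that this player strictly prefers by changing $\sigma$ only at histories where it is this player's turn. It is a subgame-perfect equilibrium if, for every finite history, the same holds for the game started at that history. Let $\Gamma$ be a represented pointclass on $\{0,1\}^{\mathbb{N}}$, i.e. a represented space whose elements are subsets of $\{0,1\}^{\mathbb{N}}$. Assume that $\emptyset,\{0,1\}^{\mathbb{N}}\in\Gamma$, that $\Gamma$ is closed, uniformly computably in the names, under the rescalings $(w,A)\mapsto wA=\{wx\mid x\in A\}$ ($w\in\{0,1\}^*$), under the inverse operation $(w,wA)\mapsto A$, and under intersection with clopen sets, and that $\Gamma$ is determined: for every $d$ and every $A\in\Gamma$, in the win/lose game where $a$ wins if the play is in $A$ and $b$ wins otherwise, one of the players has a winning strategy. Consider the following problems. - $\mathrm{Det}_\Gamma$: given $d$ (as a look-up table) and a $\Gamma$-name of $A\in\Gamma$, find a Nash equilibrium of that win/lose game. - $\mathrm{Win}_\Gamma$: on the same inputs, decide which player has a winning strategy. - $\mathrm{SPE}_\Gamma$: given a game with finitely many outcomes, with a valuation $v$ of the plays by outcomes and with antagonistic preferences ($\prec_a$ is the inverse relation of $\prec_b$, and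 the inverses of both relations are well-founded), such that $v^{-1}(U)\in\Gamma$ for every set $U$ of outcomes that is upward closed with respect to $\prec_a$ or with respect to $\prec_b$, find a subgame-perfect equilibrium. The game is given by the number of its outcomes, look-up tables for $d$, $\prec_a$, $\prec_b$, and $\Gamma$-names of all these sets $v^{-1}(U)$. Then $$\mathrm{SPE}_\Gamma\ \leq_{\mathrm W}\ \widehat{\mathrm{Win}_\Gamma}\times\widehat{\mathrm{Det}_\Gamma}.$$ -/

import Mathlib

/-! ### Baire space, Cantor space, computability -/

namespace Weih

open Encodable

/-- Baire space `ℕ^ℕ`. -/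
abbrev Baire : Type := ℕ → ℕ

/-- Cantor space `{0,1}^ℕ`. -/
abbrev Cantor : Type := ℕ → Bool

/-- The pairing `⟨p, q⟩` on Baire space: `p` on the even places, `q` on the odd places. -/
def pair (p q : Baire) : Baire := fun n => cond n.bodd (q n.div2) (p n.div2)

/-- First projection of the pairing. -/
def fstB (r : Baire) : Baire := fun n => r (2 * n)

/-- Second projection of the pairing. -/
def sndB (r : Baire) : Baire := fun n => r (2 * n + 1)

/-- The `i`-th component of `p` read as a countable tuple `⟨p₀, p₁, p₂, …⟩`. -/
def sect (p : Baire) (i : ℕ) : Baire := fun n => p (Nat.pair i n)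

/-- The countable tuple `⟨s 0, s 1, s 2, …⟩`. -/
def join (s : ℕ → Baire) : Baire := fun n => s n.unpair.1 n.unpair.2

theorem fstB_pair (p q : Baire) : fstB (pair p q) = p := by
  funext n; simp [fstB, pair, Nat.div2_val]

theorem sndB_pair (p q : Baire) : sndB (pair p q) = q := by
  funext n
  simp [sndB, pair, Nat.div2_val]

theorem sect_join (s : ℕ → Baire) (i : ℕ) : sect (join s) i = s i := by
  funext n; simp [sect, join]

/-- Partial recursive functionals: the functions `ℕ ⇀ ℕ` computed relative to an oracle
`p : ℕ → ℕ`, uniformly in `p`. The clauses are those of the partial recursive functions, together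
with oracle queries. -/
inductive OracleRec : (Baire → ℕ →. ℕ) → Prop
  | zero : OracleRec fun _ _ => Part.some 0
  | succ : OracleRec fun _ n => Part.some (n + 1)
  | left : OracleRec fun _ n => Part.some n.unpair.1
  | right : OracleRec fun _ n => Part.some n.unpair.2
  | oracle : OracleRec fun p n => Part.some (p n)
  | pair {f h : Baire → ℕ →. ℕ} (hf : OracleRec f) (hh : OracleRec h) :
      OracleRec fun p n => Nat.pair <$> f p n <*> h p n
  | comp {f h : Baire → ℕ →. ℕ} (hf : OracleRec f) (hh : OracleRec h) :
      OracleRec fun p n => h p n >>= f p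
  | prec {f h : Baire → ℕ →. ℕ} (hf : OracleRec f) (hh : OracleRec h) :
      OracleRec fun p m =>
        m.unpair.2.rec (f p m.unpair.1) fun y IH =>
          IH >>= fun i => h p (Nat.pair m.unpair.1 (Nat.pair y i))
  | rfind {f : Baire → ℕ →. ℕ} (hf : OracleRec f) :
      OracleRec fun p a =>
        Nat.rfind fun n => (fun m => decide (m = 0)) <$> f p (Nat.pair a n)

/-- A partial function on Baire space is computable if an oracle machine that is given `p` in its
domain as an oracle computes all the values of the image of `p`. -/
def ComputableFun (F : Baire →. Baire) : Prop :=
  ∃ Φ, OracleRec Φ ∧ ∀ p q, q ∈ F p → ∀ n, q n ∈ Φ p n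

/-! ### Represented spaces, multivalued functions, Weihrauch reducibility -/

/-- A represented space: a set with a partial surjection from Baire space, which is given by its
graph; `names p x` says that `p` is a name of `x`. -/
structure RepSpace where
  carrier : Type
  names : Baire → carrier → Prop
  functional : ∀ p x y, names p x → names p y → x = y
  surjective : ∀ x, ∃ p, names p x

/-- The canonical name `0ⁿ10^ℕ` of a natural number `n`. -/
def natName (n : ℕ) : Baire := fun k => if k = n then 1 else 0

theorem natName_injective {m n : ℕ} (h : natName m = natName n) : m = n := by
  by_contra hne
  have := congrFun h m
  simp [natName, hne] at this

/-- A discrete countable set, represented through codes of its elements. -/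
def discreteSpace (Y : Type) [Encodable Y] : RepSpace where
  carrier := Y
  names p y := p = natName (encode y)
  functional p x y hx hy := encode_injective (natName_injective (hx.symm.trans hy))
  surjective y := ⟨_, rfl⟩

/-- The space of functions on the finite binary words, represented as look-up tables. -/
def tableSpace (Y : Type) [Encodable Y] : RepSpace where
  carrier := List Bool → Y
  names p f := ∀ w, p (encode w) = encode (f w)
  functional p f g hf hg := funext fun w => encode_injective ((hf w).symm.trans (hg w))
  surjective f := ⟨fun n => ((decode n : Option (List Bool)).map fun w => encode (f w)).getD 0,
    fun w => by simp⟩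

/-- The product of two represented spaces. -/
def prodSpace (X Y : RepSpace) : RepSpace where
  carrier := X.carrier × Y.carrier
  names r z := X.names (fstB r) z.1 ∧ Y.names (sndB r) z.2
  functional _ _ _ hz hw :=
    Prod.ext (X.functional _ _ _ hz.1 hw.1) (Y.functional _ _ _ hz.2 hw.2)
  surjective z := by
    obtain ⟨p, hp⟩ := X.surjective z.1
    obtain ⟨q, hq⟩ := Y.surjective z.2
    exact ⟨pair p q, by rwa [fstB_pair], by rwa [sndB_pair]⟩

/-- The countable power `X^ℕ` of a represented space. -/
def seqSpace (X : RepSpace) : RepSpace where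
  carrier := ℕ → X.carrier
  names p x := ∀ i, X.names (sect p i) (x i)
  functional _ _ _ hx hy := funext fun i => X.functional _ _ _ (hx i) (hy i)
  surjective x := by
    choose s hs using fun i => X.surjective (x i)
    exact ⟨join s, fun i => by rw [sect_join]; exact hs i⟩

/-- A partial multivalued function between represented spaces: `val x` is the set of the valid
outputs on the input `x`, and `dom` is the set of the admitted inputs. -/
structure MultiFun (X Y : RepSpace) where
  dom : Set X.carrier
  val : X.carrier → Set Y.carrier

/-- `G` is a realizer of `f`: it is defined on every name of every admitted input `x`, and yields a
name of a valid output there. (So `f` has a realizer only if each admitted input has a valid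
output.) -/
def Realizes {X Y : RepSpace} (G : Baire →. Baire) (f : MultiFun X Y) : Prop :=
  ∀ p x, X.names p x → x ∈ f.dom → ∃ q ∈ G p, ∃ y ∈ f.val x, Y.names q y

/-- A multivalued function is computable if it has a computable realizer. -/
def MultiFun.IsComputable {X Y : RepSpace} (f : MultiFun X Y) : Prop :=
  ∃ F, ComputableFun F ∧ Realizes F f

/-- Weihrauch reducibility: there are computable `K`, `H` such that `K⟨id, GH⟩` is a realizer of `f`
for every realizer `G` of `g`. -/
def WeihrauchReducible {X Y Z W : RepSpace} (f : MultiFun X Y) (g : MultiFun Z W) : Prop :=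
  ∃ K H : Baire →. Baire, ComputableFun K ∧ ComputableFun H ∧
    ∀ G : Baire →. Baire, Realizes G g →
      Realizes (fun p => H p >>= fun h => G h >>= fun q => K (pair p q)) f

/-- The product `f × g`. -/
def MultiFun.prod {X Y Z W : RepSpace} (f : MultiFun X Y) (g : MultiFun Z W) :
    MultiFun (prodSpace X Z) (prodSpace Y W) where
  dom := {x | x.1 ∈ f.dom ∧ x.2 ∈ g.dom}
  val x := {y | y.1 ∈ f.val x.1 ∧ y.2 ∈ g.val x.2}

/-- The parallelization of `f`. -/
def MultiFun.parallel {X Y : RepSpace} (f : MultiFun X Y) :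
    MultiFun (seqSpace X) (seqSpace Y) where
  dom := {x | ∀ i, x i ∈ f.dom}
  val x := {y | ∀ i, y i ∈ f.val (x i)}

/-! ### Infinite sequential games -/

/-- An infinite sequential game with agents `A`, choices `C`, outcomes `O`: `d` says whose turn it
is, `v` values the plays, and `pref a x y` says that `a` strictly prefers `y` to `x`. -/
structure SeqGame (A C O : Type) where
  d : List C → A
  v : (ℕ → C) → O
  pref : A → O → O → Prop

/-- The history that is reached after `n` further moves from `l`, if `σ` is played. -/
def history {C : Type} (σ : List C → C) (l : List C) : ℕ → List C
  | 0 => l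
  | n + 1 => history σ l n ++ [σ (history σ l n)]

/-- The play that is induced by the strategy profile `σ` starting at the history `l`. -/
def play {C : Type} (σ : List C → C) (l : List C) : ℕ → C :=
  fun n => if h : n < l.length then l[n] else σ (history σ l (n - l.length))

namespace SeqGame

variable {A C O : Type}

/-- The outcome that is induced by `σ` starting at `l`. -/
def outcome (G : SeqGame A C O) (σ : List C → C) (l : List C) : O := G.v (play σ l)

/-- `τ` arises from `σ` by a change of the strategy of agent `a` alone. -/
def Deviation (G : SeqGame A C O) (a : A) (σ τ : List C → C) : Prop :=
  ∀ w, G.d w ≠ a → τ w = σ w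

/-- `σ` is an equilibrium of the game started at `l`: no agent can induce an outcome that he prefers
by changing his own strategy. -/
def IsEquilibriumAt (G : SeqGame A C O) (l : List C) (σ : List C → C) : Prop :=
  ∀ a τ, G.Deviation a σ τ → ¬ G.pref a (G.outcome σ l) (G.outcome τ l)

/-- Nash equilibria. -/
def IsNash (G : SeqGame A C O) (σ : List C → C) : Prop := G.IsEquilibriumAt [] σ

/-- Subgame-perfect equilibria. -/
def IsSubgamePerfect (G : SeqGame A C O) (σ : List C → C) : Prop :=
  ∀ l, G.IsEquilibriumAt l σ

end SeqGame

/-- The win/lose game of the players `0` and `1` with turn function `d` in which player `0` wins the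
plays in `W` and player `1` wins the other ones. The outcome is the winner, and each player prefers
to be the winner. -/
noncomputable def winLose (d : List Bool → Fin 2) (W : Set Cantor) :
    SeqGame (Fin 2) Bool (Fin 2) where
  d := d
  v := by
    classical
    exact fun x => if x ∈ W then 0 else 1
  pref i x y := x ≠ i ∧ y = i

/-- Player `i` has a winning strategy `s` in the win/lose game: whatever the moves at the histories
where it is not the turn of `i`, the induced play is won by `i`. -/
def HasWinningStrategy (d : List Bool → Fin 2) (W : Set Cantor) (i : Fin 2) : Prop :=
  ∃ s : List Bool → Bool, ∀ σ : List Bool → Bool, (∀ w, d w = i → σ w = s w) →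
    (winLose d W).outcome σ [] = i

/-! ### Represented pointclasses -/

/-- A represented pointclass over Cantor space: a partial function from Baire space to the subsets
of Cantor space (given by its graph); its members are the sets that have a name. -/
structure RepPointclass where
  names : Baire → Set Cantor → Prop
  functional : ∀ p U V, names p U → names p V → U = V

/-- The infinite sequence `wx`. -/
def prepend (w : List Bool) (x : Cantor) : Cantor :=
  fun n => if h : n < w.length then w[n] else x (n - w.length)

/-- The set `{wx | x ∈ U}`. -/
def rescale (w : List Bool) (U : Set Cantor) : Set Cantor := {y | ∃ x ∈ U, y = prepend w x}

/-- The clopen set of the sequences with a prefix in the finite list `L`; each clopen subset of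
Cantor space is of this form. -/
def clopenOf (L : List (List Bool)) : Set Cantor := {y | ∃ w ∈ L, ∃ x, y = prepend w x}

namespace RepPointclass

/-- The members of a pointclass. -/
def Mem (Γ : RepPointclass) (U : Set Cantor) : Prop := ∃ p, Γ.names p U

/-- A represented pointclass as a represented space. -/
def space (Γ : RepPointclass) : RepSpace where
  carrier := {U : Set Cantor // Γ.Mem U}
  names p U := Γ.names p U.1
  functional p U V hU hV := Subtype.ext (Γ.functional p _ _ hU hV)
  surjective U := U.2

/-- The operation `(w, U) ↦ wU`. -/
def rescaling (Γ : RepPointclass) :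
    MultiFun (prodSpace (discreteSpace (List Bool)) Γ.space) Γ.space where
  dom := Set.univ
  val z := {V | V.1 = rescale z.1 z.2.1}

/-- The inverse operation `(w, wU) ↦ U`. -/
def rescalingInv (Γ : RepPointclass) :
    MultiFun (prodSpace (discreteSpace (List Bool)) Γ.space) Γ.space where
  dom := {z | ∃ U, z.2.1 = rescale z.1 U}
  val z := {V | z.2.1 = rescale z.1 V.1}

/-- The intersection of clopen sets with members of `Γ`. -/
def clopenInter (Γ : RepPointclass) :
    MultiFun (prodSpace (discreteSpace (List (List Bool))) Γ.space) Γ.space where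
  dom := Set.univ
  val z := {V | V.1 = z.2.1 ∩ clopenOf z.1}

/-- In every win/lose game in which the winning set of the first player is in `Γ`, one of the players
has a winning strategy. -/
def IsDetermined (Γ : RepPointclass) : Prop :=
  ∀ d W, Γ.Mem W → ∃ i, HasWinningStrategy d W i

/-- The standing assumptions on a determined pointclass: it is determined, contains the empty set and
the whole space, and is closed in a uniformly computable way under rescaling, its inverse, and
intersection with clopen sets. -/
structure IsDeterminedPointclass (Γ : RepPointclass) : Prop where
  determined : Γ.IsDetermined
  empty_mem : Γ.Mem ∅
  univ_mem : Γ.Mem Set.univ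
  rescaling_computable : Γ.rescaling.IsComputable
  rescalingInv_computable : Γ.rescalingInv.IsComputable
  clopenInter_computable : Γ.clopenInter.IsComputable

end RepPointclass

/-! ### The problems `Det`, `Win` and `SPE` -/

/-- The represented space of the two-player win/lose games in which the winning set of the first
player is in `Γ`: turn function and winning set. -/
def winLoseSpace (Γ : RepPointclass) : RepSpace := prodSpace (tableSpace (Fin 2)) Γ.space

/-- `Det_Γ`: find a Nash equilibrium of a win/lose game. -/
def Det (Γ : RepPointclass) : MultiFun (winLoseSpace Γ) (tableSpace Bool) where
  dom := Set.univ
  val z := {σ | (winLose z.1 z.2.1).IsNash σ}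

/-- `Win_Γ`: decide which player has a winning strategy in a win/lose game. -/
def Win (Γ : RepPointclass) : MultiFun (winLoseSpace Γ) (discreteSpace (Fin 2)) where
  dom := Set.univ
  val z := {i | HasWinningStrategy z.1 z.2.1 i}

/-- `U` is an upper set for the relation `r`. -/
def IsUpper {O : Type} (r : O → O → Prop) (U : Set O) : Prop :=
  ∀ x ∈ U, ∀ y, r x y → y ∈ U

/-- The two-player games with choices `{0,1}`, finitely many outcomes and antagonistic preferences
with well-founded inverses, such that for each upper set of outcomes with respect to the preference
of either player, the set of the plays that result in it is in `Γ`. -/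
structure AntagonisticGame (Γ : RepPointclass) where
  numOutcomes : ℕ
  game : SeqGame (Fin 2) Bool (Fin numOutcomes)
  antagonistic : ∀ x y, game.pref 0 x y ↔ game.pref 1 y x
  wellFounded : ∀ i, WellFounded fun x y => game.pref i y x
  measurable : ∀ i U, IsUpper (game.pref i) U → Γ.Mem (game.v ⁻¹' U)

/-- The subset of `{0, …, k-1}` with characteristic word `L`. -/
def wordSet (k : ℕ) (L : List Bool) : Set (Fin k) := {x | L[x.val]? = some true}

/-- `p` is a name of an antagonistic game: its components are the number of outcomes, the look-up
table of the turn function, the look-up table of the preferences, and a family of `Γ`-names of the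
sets of plays that result in the upper sets of outcomes, which is indexed by the players and the
characteristic words of the upper sets. -/
structure AntagonisticGame.IsName {Γ : RepPointclass} (p : Baire) (G : AntagonisticGame Γ) :
    Prop where
  num : sect p 0 0 = G.numOutcomes
  turn : ∀ w : List Bool, sect p 1 (encode w) = (G.game.d w).val
  pref_pos : ∀ i x y, G.game.pref i x y → sect p 2 (encode (i, x, y)) = 1
  pref_neg : ∀ i x y, ¬ G.game.pref i x y → sect p 2 (encode (i, x, y)) = 0
  upper : ∀ (i : Fin 2) (L : List Bool), L.length = G.numOutcomes →
    IsUpper (G.game.pref i) (wordSet G.numOutcomes L) →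
      Γ.names (sect (sect p 3) (encode (i, L))) (G.game.v ⁻¹' wordSet G.numOutcomes L)

theorem exists_word {k : ℕ} (U : Set (Fin k)) :
    ∃ L : List Bool, L.length = k ∧ wordSet k L = U := by
  classical
  refine ⟨List.ofFn fun x => decide (x ∈ U), by simp, ?_⟩
  ext x
  simp [wordSet]

theorem eq_of_upper {O : Type} {r : O → O → Prop} (hr : WellFounded fun x y => r y x) {x y : O}
    (h : ∀ U, IsUpper r U → (x ∈ U ↔ y ∈ U)) : x = y := by
  have up : ∀ z, IsUpper r {u | Relation.ReflTransGen r z u} := fun z u hu w hw =>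
    Relation.ReflTransGen.tail hu hw
  have hxy : Relation.ReflTransGen r x y := (h _ (up x)).1 Relation.ReflTransGen.refl
  have hyx : Relation.ReflTransGen r y x := (h _ (up y)).2 Relation.ReflTransGen.refl
  rcases Relation.reflTransGen_iff_eq_or_transGen.1 hxy with e | t
  · exact e.symm
  · have t2 : Relation.TransGen r x x := t.trans_left hyx
    have t3 : Relation.TransGen (fun x y => r y x) x x := Relation.transGen_swap.2 t2
    exact absurd t3 (hr.transGen.irrefl.irrefl x)

/-- The represented space of antagonistic games over `Γ`. -/
def gameSpace (Γ : RepPointclass) : RepSpace where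
  carrier := AntagonisticGame Γ
  names p G := G.IsName p
  functional := by
    rintro p ⟨k, ⟨d, v, r⟩, h1, h2, h3⟩ ⟨k', ⟨d', v', r'⟩, h1', h2', h3'⟩ hG hH
    obtain rfl : k = k' := hG.num.symm.trans hH.num
    obtain rfl : d = d' := funext fun w => Fin.ext ((hG.turn w).symm.trans (hH.turn w))
    obtain rfl : r = r' := by
      funext i x y
      have a1 := hG.pref_pos i x y
      have a2 := hG.pref_neg i x y
      have b1 := hH.pref_pos i x y
      have b2 := hH.pref_neg i x y
      simp only at a1 a2 b1 b2
      apply propext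
      constructor
      · intro h
        by_contra h4
        have := (a1 h).symm.trans (b2 h4)
        omega
      · intro h
        by_contra h4
        have := (b1 h).symm.trans (a2 h4)
        omega
    obtain rfl : v = v' := by
      funext x
      refine eq_of_upper (h2 0) fun U hU => ?_
      obtain ⟨L, hL, rfl⟩ := exists_word U
      have := Γ.functional _ _ _ (hG.upper 0 L hL hU) (hH.upper 0 L hL hU)
      exact Set.ext_iff.1 this x
    rfl
  surjective G := by
    classical
    have hc : ∀ q : Fin 2 × List Bool, ∃ c : Baire,
        IsUpper (G.game.pref q.1) (wordSet G.numOutcomes q.2) →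
          Γ.names c (G.game.v ⁻¹' wordSet G.numOutcomes q.2) := fun q => by
      by_cases h : IsUpper (G.game.pref q.1) (wordSet G.numOutcomes q.2)
      · obtain ⟨c, hc⟩ := G.measurable _ _ h
        exact ⟨c, fun _ => hc⟩
      · exact ⟨fun _ => 0, fun h2 => absurd h2 h⟩
    choose c hc using hc
    let p1 : Baire := fun n => ((decode n : Option (List Bool)).map fun w => (G.game.d w).val).getD 0
    let p2 : Baire := fun n =>
      ((decode n : Option (Fin 2 × Fin G.numOutcomes × Fin G.numOutcomes)).map fun q =>
        if G.game.pref q.1 q.2.1 q.2.2 then 1 else 0).getD 0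
    let p3 : ℕ → Baire := fun n =>
      ((decode n : Option (Fin 2 × List Bool)).map c).getD fun _ => 0
    refine ⟨join fun i => if i = 0 then fun _ => G.numOutcomes else if i = 1 then p1 else
      if i = 2 then p2 else join p3, ?_, ?_, ?_, ?_, ?_⟩
    · rw [sect_join]; simp
    · intro w; rw [sect_join]; simp [p1]
    · intro i x y h; rw [sect_join]; simp [p2, h]
    · intro i x y h; rw [sect_join]; simp [p2, h]
    · intro i L _ h
      have e : p3 (encode (i, L)) = c (i, L) := by simp only [p3, encodek]; rfl
      rw [sect_join]
      simp only [show (3 : ℕ) ≠ 0 by decide, show (3 : ℕ) ≠ 1 by decide,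
        show (3 : ℕ) ≠ 2 by decide, if_false, sect_join, e]
      exact hc (i, L) h

/-- `SPE_Γ`: find a subgame-perfect equilibrium of an antagonistic game. -/
def SPE (Γ : RepPointclass) : MultiFun (gameSpace Γ) (tableSpace Bool) where
  dom := Set.univ
  val G := {σ | G.game.IsSubgamePerfect σ}

end Weih

/-! ### Oracle computability: closure properties -/

namespace Weih

open Encodable

/-! Let S_j (`chainSet`) be the set of outcomes at the top of a chain of j strict preferences of
player 0. These sets are upper and decrease from all outcomes at j = 0 to none at j = k, the number
of outcomes. By determinacy each history w has a value: the largest j such that player 0 can enforce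
S_j from w; player 1 can then enforce the complement of S_{j+1}. A profile in which both players
secure these guarantees from every history is subgame perfect: what player 0 strictly prefers to an
outcome in S_j lies in S_{j+1}, which player 1 excludes, and dually (`isSubgamePerfect_of_winning`).

A Nash equilibrium of a win/lose game contains a winning strategy of the winner
(`winning_of_isNash`), but this is good only from the root of that game, so the answers of `Det` for
all pairs (w, j) have to be glued. A player keeps the strategy adopted at an earlier prefix until
the value changes or the player leaves that strategy. Along a play in which the player obeys this
rule, the value never gets worse for this player and has finitely many levels, so from some point on
a single strategy is followed forever, and it wins (`winning_of_anchor`,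
`isSubgamePerfect_combined`).

For the reduction, a name of S_j in the subgame at w is obtained from the given names by
intersecting with the cylinder of w and undoing the rescaling (`exists_subgame_names`). All games
(w, j) are put to `Win` and `Det` at once; values, anchors and moves are then computed from the
answers by bounded recursion (`profileAt_eq`). -/

theorem bind_pfun (x : Part ℕ) (f : ℕ →. ℕ) : (x >>= f) = x.bind f := rfl

theorem mem_bind_pfun {x : Part ℕ} {f : ℕ →. ℕ} {y : ℕ} :
    y ∈ (x >>= f) ↔ ∃ b ∈ x, y ∈ f b :=
  Part.mem_bind_iff

namespace OracleRec

theorem of_eq {f g : Baire → ℕ →. ℕ} (hf : OracleRec f) (h : ∀ p n, f p n = g p n) :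
    OracleRec g := by
  obtain rfl : f = g := funext fun p => funext (h p)
  exact hf

theorem id : OracleRec fun _ n => Part.some n :=
  (OracleRec.left.pair OracleRec.right).of_eq fun _ n => by simp [Seq.seq]

theorem of_partrec {f : ℕ →. ℕ} (hf : Nat.Partrec f) : OracleRec fun _ => f := by
  induction hf with
  | zero => exact OracleRec.zero
  | succ => exact OracleRec.succ
  | left => exact OracleRec.left
  | right => exact OracleRec.right
  | pair _ _ ihf ihg => exact ihf.pair ihg
  | comp _ _ ihf ihg => exact ihf.comp ihg
  | prec _ _ ihf ihg => exact (ihf.prec ihg).of_eq fun p n => by simp [Nat.unpaired]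
  | rfind _ ihf => exact ihf.rfind

theorem comp_total {f : Baire → ℕ →. ℕ} (hf : OracleRec f) {g : ℕ → ℕ}
    (hg : Nat.Partrec fun n => g n) : OracleRec fun p n => f p (g n) :=
  (hf.comp (of_partrec hg)).of_eq fun p n => by
    rw [bind_pfun]
    exact Part.bind_some _ _

end OracleRec

theorem mem_seq_pair {x y : Part ℕ} {a : ℕ} :
    a ∈ (Nat.pair <$> x <*> y) ↔ ∃ b ∈ x, ∃ c ∈ y, Nat.pair b c = a := by
  simp [Seq.seq]

theorem partrec_of_computable {g : ℕ → ℕ} (hg : Computable g) : Nat.Partrec fun n => g n :=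
  Partrec.nat_iff.1 hg

/-- Substitution of computed oracles, uniformly in a parameter. -/
theorem OracleRec.substitution {Φ Ψ : Baire → ℕ →. ℕ} (hΦ : OracleRec Φ) (hΨ : OracleRec Ψ) :
    ∃ Θ, OracleRec Θ ∧ ∀ (p g : Baire) (i : ℕ), (∀ n, g n ∈ Ψ p (Nat.pair i n)) →
      ∀ n y, y ∈ Φ g n → y ∈ Θ p (Nat.pair i n) := by
  have hL : OracleRec fun _ n => Part.some n.unpair.1 := OracleRec.left
  induction hΦ with
  | zero => exact ⟨_, OracleRec.zero, fun p g i _ n y hy => hy⟩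
  | succ =>
    refine ⟨_, OracleRec.succ.comp OracleRec.right, fun p g i _ n y hy => ?_⟩
    simpa using hy
  | left =>
    refine ⟨_, OracleRec.left.comp OracleRec.right, fun p g i _ n y hy => ?_⟩
    simpa using hy
  | right =>
    refine ⟨_, OracleRec.right.comp OracleRec.right, fun p g i _ n y hy => ?_⟩
    simpa using hy
  | oracle =>
    -- The only case where the oracle matters: a query to `g` becomes a run of `Ψ` at the parameter
    -- `i`.
    refine ⟨_, hΨ, fun p g i h n y hy => ?_⟩
    rw [Part.mem_some_iff] at hy
    subst hy
    exact h n
  | pair _ _ ihf ihh =>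
    obtain ⟨F, hF, hF2⟩ := ihf
    obtain ⟨H, hH, hH2⟩ := ihh
    refine ⟨_, hF.pair hH, fun p g i h n y hy => ?_⟩
    rw [mem_seq_pair] at hy ⊢
    obtain ⟨b, hb, c, hc, e⟩ := hy
    exact ⟨b, hF2 p g i h n b hb, c, hH2 p g i h n c hc, e⟩
  | comp _ _ ihf ihh =>
    obtain ⟨F, hF, hF2⟩ := ihf
    obtain ⟨H, hH, hH2⟩ := ihh
    -- The parameter `i` has to be handed on to the outer function together with the intermediate
    -- value.
    refine ⟨_, hF.comp (hL.pair hH), fun p g i h n y hy => ?_⟩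
    rw [mem_bind_pfun] at hy ⊢
    obtain ⟨b, hb, hy⟩ := hy
    exact ⟨Nat.pair i b, mem_seq_pair.2 ⟨i, by simp, b, hH2 p g i h n b hb, rfl⟩,
      hF2 p g i h b y hy⟩
  | @prec f k _ _ ihf ihh =>
    obtain ⟨F, hF, hF2⟩ := ihf
    obtain ⟨H, hH, hH2⟩ := ihh
    -- Reassociation: recursion treats (i, a) as its parameter, whereas the induction hypotheses
    -- expect `i` alone in front. `c1` sends ((i, a), z) to (i, (a, z)), and `c2` sends (i, (a, t))
    -- to ((i, a), t).
    have c1 : Nat.Partrec fun n : ℕ =>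
        ((Nat.pair n.unpair.1.unpair.1 (Nat.pair n.unpair.1.unpair.2 n.unpair.2) : ℕ) :
          Part ℕ) := by
      refine partrec_of_computable (Primrec.to_comp ?_)
      have u : Primrec Nat.unpair := Primrec.unpair
      have u1 : Primrec fun n : ℕ => n.unpair.1 := Primrec.fst.comp u
      have u2 : Primrec fun n : ℕ => n.unpair.2 := Primrec.snd.comp u
      exact Primrec₂.natPair.comp (u1.comp u1) (Primrec₂.natPair.comp (u2.comp u1) u2)
    have c2 : Nat.Partrec fun n : ℕ =>
        ((Nat.pair (Nat.pair n.unpair.1 n.unpair.2.unpair.1) n.unpair.2.unpair.2 : ℕ) :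
          Part ℕ) := by
      refine partrec_of_computable (Primrec.to_comp ?_)
      have u : Primrec Nat.unpair := Primrec.unpair
      have u1 : Primrec fun n : ℕ => n.unpair.1 := Primrec.fst.comp u
      have u2 : Primrec fun n : ℕ => n.unpair.2 := Primrec.snd.comp u
      exact Primrec₂.natPair.comp (Primrec₂.natPair.comp u1 (u1.comp u2)) (u2.comp u2)
    refine ⟨_, (hF.prec (hH.comp_total c1)).comp_total c2, fun p g i h n y hy => ?_⟩
    simp only [Nat.unpair_pair]
    revert hy
    dsimp only
    generalize n.unpair.2 = t
    intro hy
    induction t generalizing y with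
    | zero => exact hF2 p g i h _ y hy
    | succ t ih =>
      simp only [Part.bind_eq_bind, Part.mem_bind_iff] at hy ⊢
      obtain ⟨b, hb, hy⟩ := hy
      exact ⟨b, ih b hb, hH2 p g i h _ y hy⟩
  | @rfind f _ ihf =>
    obtain ⟨F, hF, hF2⟩ := ihf
    have c1 : Nat.Partrec fun n : ℕ =>
        ((Nat.pair n.unpair.1.unpair.1 (Nat.pair n.unpair.1.unpair.2 n.unpair.2) : ℕ) :
          Part ℕ) := by
      refine partrec_of_computable (Primrec.to_comp ?_)
      have u : Primrec Nat.unpair := Primrec.unpair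
      have u1 : Primrec fun n : ℕ => n.unpair.1 := Primrec.fst.comp u
      have u2 : Primrec fun n : ℕ => n.unpair.2 := Primrec.snd.comp u
      exact Primrec₂.natPair.comp (u1.comp u1) (Primrec₂.natPair.comp (u2.comp u1) u2)
    refine ⟨_, (hF.comp_total c1).rfind, fun p g i h n y hy => ?_⟩
    obtain ⟨h1, h2⟩ := Nat.mem_rfind.1 hy
    simp only [Nat.unpair_pair]
    refine Nat.mem_rfind.2 ⟨?_, fun {t} ht => ?_⟩
    · obtain ⟨m, hm, hm2⟩ := (Part.mem_map_iff _).1 h1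
      exact (Part.mem_map_iff _).2 ⟨m, hF2 p g i h _ m hm, hm2⟩
    · obtain ⟨m, hm, hm2⟩ := (Part.mem_map_iff _).1 (h2 ht)
      exact (Part.mem_map_iff _).2 ⟨m, hF2 p g i h _ m hm, hm2⟩

/-! ### Computability between countable types, uniformly in an oracle -/

/-- `f` is computable relative to its first argument, uniformly on the set `D` of oracles. -/
def OracleComp {α β : Type} [Primcodable α] [Primcodable β] (D : Set Baire)
    (f : Baire → α → β) : Prop :=
  ∃ Φ, OracleRec Φ ∧ ∀ p ∈ D, ∀ a, encode (f p a) ∈ Φ p (encode a)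

/-- The partial function on Baire space with domain `D` that is given by `F`. -/
def restrict (D : Set Baire) (F : Baire → Baire) : Baire →. Baire := fun p => ⟨p ∈ D, fun _ => F p⟩

theorem mem_restrict {D : Set Baire} {F : Baire → Baire} {p q : Baire} :
    q ∈ restrict D F p ↔ p ∈ D ∧ q = F p := by
  constructor
  · rintro ⟨h, rfl⟩
    exact ⟨h, rfl⟩
  · rintro ⟨h, rfl⟩
    exact ⟨h, rfl⟩

namespace OracleComp

variable {α β γ δ : Type} [Primcodable α] [Primcodable β] [Primcodable γ] [Primcodable δ]
  {D : Set Baire}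

theorem computableFun {F : Baire → Baire} (hF : OracleComp D F) :
    ComputableFun (restrict D F) := by
  obtain ⟨Φ, hΦ, h⟩ := hF
  refine ⟨Φ, hΦ, fun p q hq n => ?_⟩
  obtain ⟨hp, rfl⟩ := mem_restrict.1 hq
  simpa using h p hp n

theorem of_computable {g : α → β} (hg : Computable g) : OracleComp D fun _ => g :=
  ⟨_, OracleRec.of_partrec hg, fun p _ a => by simp⟩

theorem of_primrec {g : α → β} (hg : Primrec g) : OracleComp D fun _ => g :=
  of_computable hg.to_comp

theorem congr {f g : Baire → α → β} (hf : OracleComp D f) (h : ∀ p ∈ D, ∀ a, f p a = g p a) :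
    OracleComp D g := by
  obtain ⟨Φ, hΦ, hf⟩ := hf
  exact ⟨Φ, hΦ, fun p hp a => h p hp a ▸ hf p hp a⟩

theorem comp {g : Baire → β → γ} {f : Baire → α → β} (hg : OracleComp D g)
    (hf : OracleComp D f) : OracleComp D fun p a => g p (f p a) := by
  obtain ⟨Φ, hΦ, hf⟩ := hf
  obtain ⟨Ψ, hΨ, hg⟩ := hg
  refine ⟨_, hΨ.comp hΦ, fun p hp a => ?_⟩
  rw [mem_bind_pfun]
  exact ⟨_, hf p hp a, hg p hp _⟩

theorem mk {f : Baire → α → β} {g : Baire → α → γ} (hf : OracleComp D f)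
    (hg : OracleComp D g) : OracleComp D fun p a => (f p a, g p a) := by
  obtain ⟨Φ, hΦ, hf⟩ := hf
  obtain ⟨Ψ, hΨ, hg⟩ := hg
  exact ⟨_, hΦ.pair hΨ, fun p hp a => mem_seq_pair.2 ⟨_, hf p hp a, _, hg p hp a, rfl⟩⟩

theorem map {g : β → γ} (hg : Primrec g) {f : Baire → α → β} (hf : OracleComp D f) :
    OracleComp D fun p a => g (f p a) :=
  (of_primrec hg).comp hf

theorem map₂ {h : β → γ → δ} (hh : Primrec₂ h) {f : Baire → α → β} {g : Baire → α → γ}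
    (hf : OracleComp D f) (hg : OracleComp D g) : OracleComp D fun p a => h (f p a) (g p a) :=
  (of_primrec hh).comp (hf.mk hg)

theorem const (b : β) : OracleComp D fun _ (_ : α) => b := of_primrec (Primrec.const b)

theorem fst : OracleComp D fun _ (a : α × β) => a.1 := of_primrec Primrec.fst

theorem snd : OracleComp D fun _ (a : α × β) => a.2 := of_primrec Primrec.snd

theorem query {f : Baire → α → ℕ} (hf : OracleComp D f) : OracleComp D fun p a => p (f p a) := by
  have : OracleComp D fun (p : Baire) (n : ℕ) => p n :=
    ⟨_, OracleRec.oracle, fun p _ n => by simp⟩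
  exact this.comp hf

theorem nat_rec {f : Baire → α → ℕ} {g : Baire → α → β} {h : Baire → α × ℕ × β → β}
    (hf : OracleComp D f) (hg : OracleComp D g) (hh : OracleComp D h) :
    OracleComp D fun p a => Nat.rec (motive := fun _ => β) (g p a) (fun y b => h p (a, y, b))
      (f p a) := by
  obtain ⟨F, hF, hf⟩ := hf
  obtain ⟨G, hG, hg⟩ := hg
  obtain ⟨H, hH, hh⟩ := hh
  refine ⟨_, (hG.prec hH).comp (OracleRec.id.pair hF), fun p hp a => ?_⟩
  refine mem_bind_pfun.2 ⟨Nat.pair (encode a) (f p a), mem_seq_pair.2 ⟨_, by simp, _, hf p hp a, rfl⟩, ?_⟩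
  simp only [Nat.unpair_pair]
  generalize f p a = t
  induction t with
  | zero => exact hg p hp a
  | succ t ih =>
    simp only [Part.bind_eq_bind, Part.mem_bind_iff]
    exact ⟨_, ih, hh p hp (a, t, _)⟩

theorem range_map {f : Baire → α → ℕ} {g : Baire → α × ℕ → β} (hf : OracleComp D f)
    (hg : OracleComp D g) : OracleComp D fun p a => (List.range (f p a)).map fun n => g p (a, n) := by
  have h : OracleComp D fun p (x : α × ℕ × List β) => x.2.2 ++ [g p (x.1, x.2.1)] :=
    map₂ Primrec.list_concat (snd.comp snd)
      (hg.comp (fst.mk (fst.comp snd)))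
  refine (hf.nat_rec (const []) h).congr fun p _ a => ?_
  generalize f p a = t
  induction t with
  | zero => rfl
  | succ t ih => rw [List.range_succ, List.map_append, ← ih]; rfl

/-- Application of a computable functional to computed oracles. -/
theorem apply {Φ : Baire → ℕ →. ℕ} (hΦ : OracleRec Φ) {g q : Baire → α × ℕ → ℕ}
    (hg : OracleComp D g) (h : ∀ p ∈ D, ∀ a n, q p (a, n) ∈ Φ (fun m => g p (a, m)) n) :
    OracleComp D q := by
  obtain ⟨Ψ, hΨ, hg⟩ := hg
  obtain ⟨Θ, hΘ, hs⟩ := hΦ.substitution hΨ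
  refine ⟨Θ, hΘ, fun p hp a => ?_⟩
  exact hs p _ _ (fun n => hg p hp (a.1, n)) _ _ (h p hp a.1 a.2)

end OracleComp

end Weih

/-! ### Plays and winning strategies -/

namespace Weih

/-- The prefix of length `n` of `x`. -/
def pre (x : Cantor) (n : ℕ) : List Bool := (List.range n).map x

@[simp] theorem length_pre (x : Cantor) (n : ℕ) : (pre x n).length = n := by simp [pre]

@[simp] theorem pre_zero (x : Cantor) : pre x 0 = [] := rfl

theorem pre_succ (x : Cantor) (n : ℕ) : pre x (n + 1) = pre x n ++ [x n] := by
  simp [pre, List.range_succ]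

theorem pre_congr {x y : Cantor} {n : ℕ} : pre x n = pre y n ↔ ∀ m < n, x m = y m := by
  simp [pre, List.map_inj_left]

theorem take_pre (x : Cantor) {m n : ℕ} (h : m ≤ n) : (pre x n).take m = pre x m := by
  rw [pre, ← List.map_take, List.take_range, min_eq_left h, pre]

theorem pre_eq_iff {x : Cantor} {l : List Bool} :
    pre x l.length = l ↔ ∀ m (h : m < l.length), x m = l[m] := by
  constructor
  · intro h m hm
    have : (pre x l.length)[m]? = l[m]? := by rw [h]
    simpa [pre, hm] using this
  · intro h
    refine List.ext_getElem (by simp) fun m h1 h2 => ?_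
    simpa [pre] using h m h2

theorem play_of_lt (σ : List Bool → Bool) {l : List Bool} {m : ℕ} (h : m < l.length) :
    play σ l m = l[m] := by
  simp [play, h]

theorem pre_play_length (σ : List Bool → Bool) (l : List Bool) : pre (play σ l) l.length = l :=
  pre_eq_iff.2 fun _ h => play_of_lt σ h

theorem pre_play_add (σ : List Bool → Bool) (l : List Bool) (n : ℕ) :
    pre (play σ l) (l.length + n) = history σ l n := by
  induction n with
  | zero => exact pre_play_length σ l
  | succ n ih =>
    rw [← add_assoc, pre_succ, ih]
    simp [play, history]

theorem play_apply (σ : List Bool → Bool) (l : List Bool) {n : ℕ} (h : l.length ≤ n) :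
    play σ l n = σ (pre (play σ l) n) := by
  obtain ⟨m, rfl⟩ := Nat.exists_eq_add_of_le h
  rw [pre_play_add]
  simp [play]

theorem play_eq {σ : List Bool → Bool} {l : List Bool} {x : Cantor} (h : pre x l.length = l)
    (hx : ∀ n, l.length ≤ n → x n = σ (pre x n)) : play σ l = x := by
  funext n
  induction n using Nat.strong_induction_on with
  | _ n ih =>
    rcases lt_or_ge n l.length with hn | hn
    · rw [play_of_lt σ hn, pre_eq_iff.1 h n hn]
    · rw [play_apply σ l hn, hx n hn, pre_congr.2 ih]

theorem prepend_add (l : List Bool) (y : Cantor) (n : ℕ) : prepend l y (l.length + n) = y n := by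
  simp [prepend]

theorem pre_prepend (l : List Bool) (y : Cantor) (n : ℕ) :
    pre (prepend l y) (l.length + n) = l ++ pre y n := by
  induction n with
  | zero =>
    simp only [add_zero, pre_zero, List.append_nil]
    exact pre_eq_iff.2 fun m hm => by simp [prepend, hm]
  | succ n ih => rw [← add_assoc, pre_succ, ih, prepend_add, pre_succ, List.append_assoc]

theorem prepend_injective (l : List Bool) : Function.Injective (prepend l) := fun x y h =>
  funext fun n => by rw [← prepend_add l x, h, prepend_add]

theorem eq_prepend {x : Cantor} {l : List Bool} (h : pre x l.length = l) :
    x = prepend l fun n => x (l.length + n) := by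
  funext n
  rcases lt_or_ge n l.length with hn | hn
  · simp [prepend, hn, pre_eq_iff.1 h n hn]
  · obtain ⟨m, rfl⟩ := Nat.exists_eq_add_of_le hn
    rw [prepend_add]

/-- Player `i` enforces from the history `l` on that the play is in `S` by following `s`. -/
def Winning (d : List Bool → Fin 2) (i : Fin 2) (s : List Bool → Bool) (l : List Bool)
    (S : Set Cantor) : Prop :=
  ∀ x, pre x l.length = l → (∀ n, l.length ≤ n → d (pre x n) = i → x n = s (pre x n)) → x ∈ S

/-- The plays that player `i` wins in the win/lose game with winning set `W` of player `0`. -/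
def side (i : Fin 2) (W : Set Cantor) : Set Cantor := if i = 0 then W else Wᶜ

theorem outcome_eq_iff {d : List Bool → Fin 2} {W : Set Cantor} {i : Fin 2}
    {σ : List Bool → Bool} {l : List Bool} :
    (winLose d W).outcome σ l = i ↔ play σ l ∈ side i W := by
  have h : ∀ i : Fin 2, i = 0 ∨ i = 1 := by decide
  rcases h i with rfl | rfl <;> by_cases hx : play σ l ∈ W <;>
    simp [SeqGame.outcome, winLose, side, hx]

theorem Winning.play_mem {d : List Bool → Fin 2} {i : Fin 2} {s σ : List Bool → Bool}
    {l : List Bool} {S : Set Cantor} (h : Winning d i s l S) (hσ : ∀ w, d w = i → σ w = s w) :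
    play σ l ∈ S :=
  h _ (pre_play_length σ l) fun _ hn hd => (play_apply σ l hn).trans (hσ _ hd)

theorem winning_of_play {d : List Bool → Fin 2} {i : Fin 2} {s : List Bool → Bool}
    {l : List Bool} {S : Set Cantor}
    (h : ∀ σ : List Bool → Bool, (∀ w, d w = i → σ w = s w) → play σ l ∈ S) :
    Winning d i s l S := by
  intro x hl hx
  -- The opponent's moves are read off from `x` itself, by the length of the history, so that `x` is
  -- the play of this profile.
  have := h (fun w => if d w = i then s w else x w.length) fun w hw => by simp [hw]
  rwa [play_eq hl] at this
  intro n hn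
  by_cases hd : d (pre x n) = i
  · simp [hd, hx n hn hd]
  · simp [hd]

/-- The equilibrium outcome must be `i`, since otherwise `i` would switch to a winning strategy.
Hence any play against the moves of `i` that `i` loses would be a profitable deviation of the
opponent. -/
theorem winning_of_isNash {d : List Bool → Fin 2} {W : Set Cantor} {i : Fin 2}
    {σ : List Bool → Bool} (hi : HasWinningStrategy d W i) (hσ : (winLose d W).IsNash σ) :
    Winning d i σ [] (side i W) := by
  have ho : (winLose d W).outcome σ [] = i := by
    obtain ⟨s, hs⟩ := hi
    by_contra hne
    refine hσ i (fun w => if d w = i then s w else σ w) (fun w hw => ?_) ⟨hne, hs _ fun w hw => ?_⟩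
    · exact if_neg hw
    · exact if_pos hw
  refine winning_of_play fun τ hτ => (outcome_eq_iff (d := d)).1 ?_
  by_contra hne
  refine hσ ((winLose d W).outcome τ []) τ (fun w hw => hτ w ?_) ⟨ho ▸ Ne.symm hne, rfl⟩
  have h3 : ∀ a b c : Fin 2, a ≠ b → c ≠ b → a = c := by decide
  exact h3 _ _ _ hw (Ne.symm hne)

/-- Transfers a strategy for the subgame, whose root is the empty history, to the whole game, where
histories carry the prefix `l`. -/
theorem Winning.shift {d : List Bool → Fin 2} {i : Fin 2} {s : List Bool → Bool} {l : List Bool}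
    {S : Set Cantor} (h : Winning (fun u => d (l ++ u)) i s [] (prepend l ⁻¹' S)) :
    Winning d i (fun w => s (w.drop l.length)) l S := by
  intro x hl hx
  have hp := eq_prepend hl
  have key : ∀ n, pre x (l.length + n) = l ++ pre (fun n => x (l.length + n)) n := fun n => by
    rw [← pre_prepend, ← hp]
  rw [hp]
  refine h _ rfl fun n _ hd => ?_
  dsimp only at hd
  rw [← key] at hd
  have := hx _ (Nat.le_add_right _ _) hd
  dsimp only at this
  rwa [key, List.drop_left] at this

/-- The two strategies are played against each other. -/
theorem Winning.not_compl {d : List Bool → Fin 2} {s t : List Bool → Bool} {l : List Bool}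
    {S : Set Cantor} (hs : Winning d 0 s l S) (ht : Winning d 1 t l Sᶜ) : False := by
  have h1 := hs.play_mem (σ := fun w => if d w = 0 then s w else t w) fun w hw => by simp [hw]
  have h2 := ht.play_mem (σ := fun w => if d w = 0 then s w else t w) fun w hw => by simp [hw]
  exact h2 h1

theorem Winning.mono {d : List Bool → Fin 2} {i : Fin 2} {s : List Bool → Bool} {l : List Bool}
    {S T : Set Cantor} (h : Winning d i s l S) (hST : S ⊆ T) : Winning d i s l T :=
  fun x hl hx => hST (h x hl hx)

theorem preimage_side (f : Cantor → Cantor) (i : Fin 2) (W : Set Cantor) :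
    f ⁻¹' side i W = side i (f ⁻¹' W) := by
  unfold side
  split_ifs <;> rfl

/-! ### Combining local strategies into a subgame-perfect profile -/

/-- The length of the prefix of `w.take n` at which player `i` has adopted the strategy that is in
force at `w.take n`: a new strategy is adopted whenever the value changes, and whenever player `i`
deviates from the strategy in force. -/
def anchor (d : List Bool → Fin 2) (val : List Bool → ℕ) (s : List Bool → List Bool → Bool)
    (i : Fin 2) (w : List Bool) : ℕ → ℕ
  | 0 => 0
  | n + 1 =>
    if val (w.take (n + 1)) = val (w.take n) ∧ (d (w.take n) = i →
        w.take (n + 1) = w.take n ++ [s (w.take (anchor d val s i w n)) (w.take n)])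
    then anchor d val s i w n else n + 1

section Anchor

variable {d : List Bool → Fin 2} {val : List Bool → ℕ} {s : List Bool → List Bool → Bool}
  {i : Fin 2}

theorem anchor_le (w : List Bool) (n : ℕ) : anchor d val s i w n ≤ n := by
  induction n with
  | zero => exact le_rfl
  | succ n ih =>
    rw [anchor]
    split_ifs
    · omega
    · exact le_rfl

/-- The first `n` steps of the recursion look only at the first `n` bits, so anchors can be followed
along an infinite play. -/
theorem anchor_congr {w w' : List Bool} {n : ℕ} (h : w.take n = w'.take n) :
    anchor d val s i w n = anchor d val s i w' n := by
  induction n with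
  | zero => rfl
  | succ n ih =>
    have h1 : ∀ m ≤ n + 1, w.take m = w'.take m := fun m hm => by
      have := congrArg (List.take m) h
      rwa [List.take_take, List.take_take, min_eq_left hm] at this
    have ih := ih (h1 n (by omega))
    have ha := anchor_le (d := d) (val := val) (s := s) (i := i) w' n
    rw [anchor, anchor, ih, h, h1 n (by omega), h1 _ (by omega : anchor d val s i w' n ≤ n + 1)]

theorem anchor_pre_succ (x : Cantor) (n : ℕ) :
    anchor d val s i (pre x (n + 1)) (n + 1) =
      if val (pre x (n + 1)) = val (pre x n) ∧
        (d (pre x n) = i → x n = s (pre x (anchor d val s i (pre x n) n)) (pre x n))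
      then anchor d val s i (pre x n) n else n + 1 := by
  have h : anchor d val s i (pre x (n + 1)) n = anchor d val s i (pre x n) n :=
    anchor_congr (by rw [take_pre x (Nat.le_succ n), take_pre x le_rfl])
  have ha := anchor_le (d := d) (val := val) (s := s) (i := i) (pre x n) n
  rw [anchor, h, take_pre x le_rfl, take_pre x (Nat.le_succ n), take_pre x (by omega), pre_succ x n]
  simp

/-- The invariant behind anchors: since the last reset the value is unchanged and player `i` has
obeyed the strategy adopted there. At a reset itself the second part is vacuous. -/
theorem anchor_spec (x : Cantor) (n : ℕ) :
    val (pre x n) = val (pre x (anchor d val s i (pre x n) n)) ∧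
      ∀ m, anchor d val s i (pre x n) n ≤ m → m < n → d (pre x m) = i →
        x m = s (pre x (anchor d val s i (pre x n) n)) (pre x m) := by
  induction n with
  | zero => exact ⟨rfl, fun m _ hm => absurd hm (by omega)⟩
  | succ n ih =>
    rw [anchor_pre_succ]
    split_ifs with h
    · refine ⟨h.1.trans ih.1, fun m h1 h2 hd => ?_⟩
      rcases Nat.lt_succ_iff_lt_or_eq.1 h2 with h3 | rfl
      · exact ih.2 m h1 h3 hd
      · exact h.2 hd
    · exact ⟨rfl, fun m h1 h2 => absurd h2 (by omega)⟩

/-- By `anchor_spec`, a continuation that obeys the strategy in force obeys it from the anchor on,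
where it was winning for the same value. -/
theorem winning_at_anchor {T : ℕ → Set Cantor} (hs : ∀ r, Winning d i (s r) r (T (val r)))
    (x : Cantor) (n : ℕ) :
    Winning d i (s (pre x (anchor d val s i (pre x n) n))) (pre x n) (T (val (pre x n))) := by
  obtain ⟨h1, h2⟩ := anchor_spec (d := d) (val := val) (s := s) (i := i) x n
  have ha := anchor_le (d := d) (val := val) (s := s) (i := i) (pre x n) n
  intro y hy hy2
  rw [length_pre] at hy hy2
  have hxy : ∀ m ≤ n, pre y m = pre x m := fun m hm =>
    pre_congr.2 fun j hj => pre_congr.1 hy j (by omega)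
  rw [h1]
  refine hs _ y (by rw [length_pre]; exact hxy _ ha) fun m hm hd => ?_
  rw [length_pre] at hm
  rcases lt_or_ge m n with hmn | hmn
  · rw [hxy m hmn.le] at hd ⊢
    rw [pre_congr.1 hy m hmn]
    exact h2 m hm hmn hd
  · exact hy2 m hmn hd

/-- A player who always follows the strategy in force secures the current value, provided that the
values, as rated by `μ`, cannot improve infinitely often. -/
theorem winning_of_anchor {T : ℕ → Set Cantor} {μ : ℕ → ℕ} {k : ℕ} {σ : List Bool → Bool}
    (hk : ∀ w, μ (val w) ≤ k)
    (hμ : ∀ w w', μ (val w) = μ (val w') → val w = val w')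
    (hT : ∀ w w', μ (val w) ≤ μ (val w') → T (val w') ⊆ T (val w))
    (hval : ∀ t l l', Winning d i t l (T (val l')) → μ (val l') ≤ μ (val l))
    (hs : ∀ r, Winning d i (s r) r (T (val r)))
    (hσ : ∀ w, d w = i → σ w = s (w.take (anchor d val s i w w.length)) w) (l : List Bool) :
    Winning d i σ l (T (val l)) := by
  intro x hl hx
  have hmove : ∀ n, l.length ≤ n → d (pre x n) = i →
      x n = s (pre x (anchor d val s i (pre x n) n)) (pre x n) := fun n hn hd => by
    rw [hx n hn hd, hσ _ hd, length_pre,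
      take_pre x (anchor_le (d := d) (val := val) (s := s) (i := i) (pre x n) n)]
  -- The strategy in force still wins the old target after one more move, so the value at the new
  -- history, being optimal by `hval`, is rated at least as high.
  have hstep : ∀ n, l.length ≤ n → μ (val (pre x n)) ≤ μ (val (pre x (n + 1))) := fun n hn => by
    refine hval (s (pre x (anchor d val s i (pre x n) n))) _ _ fun y hy hy2 => ?_
    rw [length_pre] at hy hy2
    refine winning_at_anchor hs x n y ?_ fun m hm hd => ?_
    · rw [length_pre]
      exact pre_congr.2 fun j hj => pre_congr.1 hy j (by omega)
    · rw [length_pre] at hm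
      rcases hm.eq_or_lt with rfl | hm
      · have : pre y n = pre x n := pre_congr.2 fun j hj => pre_congr.1 hy j (by omega)
        rw [this] at hd ⊢
        rw [pre_congr.1 hy n (by omega)]
        exact hmove n hn hd
      · exact hy2 m hm hd
  have hmono : ∀ m n, l.length ≤ m → m ≤ n → μ (val (pre x m)) ≤ μ (val (pre x n)) :=
    fun m n hm hmn => by
      induction n, hmn using Nat.le_induction with
      | base => exact le_rfl
      | succ n hmn ih => exact ih.trans (hstep n (hm.trans hmn))
  -- `N` is a position of maximal rating along `x`. Beyond it the value is constant and player `i`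
  -- obeys, so the anchor never moves again.
  obtain ⟨N, hN, hmax⟩ := (measure fun n => k - μ (val (pre x n))).wf.has_min
    {n | l.length ≤ n} ⟨l.length, show l.length ≤ l.length from le_rfl⟩
  have hN : l.length ≤ N := hN
  have hconst : ∀ n, N ≤ n → val (pre x n) = val (pre x N) := fun n hn => by
    have h1 := hmono N n hN hn
    have h2 : ¬ k - μ (val (pre x n)) < k - μ (val (pre x N)) := hmax n (hN.trans hn)
    have h3 := hk (pre x n)
    exact hμ _ _ (by omega)
  have hanchor : ∀ n, N ≤ n →
      anchor d val s i (pre x n) n = anchor d val s i (pre x N) N := fun n hn => by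
    induction n, hn using Nat.le_induction with
    | base => rfl
    | succ n hn ih =>
      rw [anchor_pre_succ, if_pos, ih]
      exact ⟨(hconst _ (by omega)).trans (hconst n hn).symm, hmove n (hN.trans hn)⟩
  have hlx : μ (val l) ≤ μ (val (pre x N)) := by
    have := hmono l.length N le_rfl hN
    rwa [hl] at this
  -- The strategy fixed at `N` wins the target at `N`, which is contained in the target at `l`.
  refine hT _ _ hlx (winning_at_anchor hs x N x (by rw [length_pre]) fun n hn hd => ?_)
  rw [length_pre] at hn
  rw [← hanchor n hn]
  exact hmove n (hN.trans hn) hd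

end Anchor

/-- The outcome at `l` lies in `U (val l)` but not in `U (val l + 1)`. A deviation of player 0 stays
outside the latter, while an improvement would enter it. A deviation of player 1 stays in the
former, so if it were an improvement, the original outcome would lie one level higher. -/
theorem isSubgamePerfect_of_winning {O : Type} {G : SeqGame (Fin 2) Bool O}
    (hG : ∀ x y, G.pref 0 x y ↔ G.pref 1 y x) {U : ℕ → Set O}
    (hU : ∀ j x y, x ∈ U j → G.pref 0 x y → y ∈ U (j + 1)) {val : List Bool → ℕ}
    {σ : List Bool → Bool} (h0 : ∀ l, Winning G.d 0 σ l (G.v ⁻¹' U (val l)))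
    (h1 : ∀ l, Winning G.d 1 σ l (G.v ⁻¹' U (val l + 1))ᶜ) : G.IsSubgamePerfect σ := by
  intro l a τ hτ hp
  have two : ∀ i : Fin 2, i = 0 ∨ i = 1 := by decide
  have e0 := (h0 l).play_mem (σ := σ) fun _ _ => rfl
  have e1 := (h1 l).play_mem (σ := σ) fun _ _ => rfl
  rcases two a with rfl | rfl
  · exact (h1 l).play_mem (σ := τ) (fun w hw => hτ w (by simp [hw])) (hU _ _ _ e0 hp)
  · exact e1 (hU _ _ _ ((h0 l).play_mem (σ := τ) fun w hw => hτ w (by simp [hw]))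
      ((hG _ _).2 hp))

/-! ### Threshold sets and the glued profile -/

/-- The outcomes that are the top of a chain of length `j`. -/
def chainSet {O : Type} (r : O → O → Prop) : ℕ → Set O
  | 0 => Set.univ
  | j + 1 => {x | ∃ y ∈ chainSet r j, r y x}

theorem chainSet_succ_subset {O : Type} (r : O → O → Prop) (j : ℕ) :
    chainSet r (j + 1) ⊆ chainSet r j := by
  induction j with
  | zero => exact fun _ _ => trivial
  | succ j ih => exact fun x ⟨y, hy, hr⟩ => ⟨y, ih hy, hr⟩

theorem chainSet_antitone {O : Type} (r : O → O → Prop) : Antitone (chainSet r) :=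
  antitone_nat_of_succ_le (chainSet_succ_subset r)

theorem isUpper_chainSet {O : Type} (r : O → O → Prop) (j : ℕ) : IsUpper r (chainSet r j) :=
  fun x hx _ hr => chainSet_succ_subset r j ⟨x, hx, hr⟩

/-- The top of a chain of length `j` has at least `j` strict predecessors in the transitive closure,
and never itself by well-foundedness, so `j < k`. The closure is needed because preferences need not
be transitive. -/
theorem chainSet_card {k : ℕ} {r : Fin k → Fin k → Prop} (hr : WellFounded fun x y => r y x) :
    chainSet r k = ∅ := by
  have irr : ∀ x, ¬ Relation.TransGen r x x := fun x h => by
    have : Relation.TransGen (fun x y => r y x) x x := Relation.transGen_swap.2 h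
    exact hr.transGen.irrefl.irrefl x this
  have key : ∀ j x, x ∈ chainSet r j → j ≤ {y | Relation.TransGen r y x}.ncard := by
    intro j
    induction j with
    | zero => exact fun _ _ => Nat.zero_le _
    | succ j ih =>
      rintro x ⟨y, hy, hyx⟩
      have hlt : {z | Relation.TransGen r z y} ⊂ {z | Relation.TransGen r z x} :=
        ⟨fun z hz => Relation.TransGen.tail hz hyx, fun h => irr y (h (Relation.TransGen.single hyx))⟩
      exact (ih y hy).trans_lt (Set.ncard_lt_ncard hlt (Set.toFinite _))
  refine Set.eq_empty_of_forall_notMem fun x hx => ?_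
  have h2 : {y | Relation.TransGen r y x}.ncard < (Set.univ : Set (Fin k)).ncard :=
    Set.ncard_lt_ncard ⟨Set.subset_univ _, fun h => irr x (h trivial)⟩ (Set.toFinite _)
  have h3 := key k x hx
  simp [Set.ncard_univ] at h2
  omega

/-- The value of the subgame at `w`, where `win w j` is the winner of the game in which player `0`
aims at the `j`-th of a decreasing family of sets. -/
def gameValue (win : List Bool → ℕ → Fin 2) (k : ℕ) (w : List Bool) : ℕ :=
  Nat.findGreatest (fun j => win w j = 0) k

/-- The strategy profile in which each player follows the strategy in force, where `s w j` is a
strategy for the threshold `j` in the subgame at `w`. -/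
def combined (d : List Bool → Fin 2) (val : List Bool → ℕ)
    (s : List Bool → ℕ → List Bool → Bool) (w : List Bool) : Bool :=
  let r := w.take (anchor d val (fun r u => s r (val r + (d w).val) (u.drop r.length)) (d w) w
    w.length)
  s r (val r + (d w).val) (w.drop r.length)

theorem isSubgamePerfect_combined {k : ℕ} {G : SeqGame (Fin 2) Bool (Fin k)}
    (hG : ∀ x y, G.pref 0 x y ↔ G.pref 1 y x) (hwf : WellFounded fun x y => G.pref 0 y x)
    {win : List Bool → ℕ → Fin 2} {s : List Bool → ℕ → List Bool → Bool}
    (hwin : ∀ w j, HasWinningStrategy (fun u => G.d (w ++ u))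
      (prepend w ⁻¹' (G.v ⁻¹' chainSet (G.pref 0) j)) (win w j))
    (hs : ∀ w j, (winLose (fun u => G.d (w ++ u))
      (prepend w ⁻¹' (G.v ⁻¹' chainSet (G.pref 0) j))).IsNash (s w j)) :
    G.IsSubgamePerfect (combined G.d (gameValue win k) s) := by
  set S : ℕ → Set Cantor := fun j => G.v ⁻¹' chainSet (G.pref 0) j with hS
  set val := gameValue win k with hval
  have hSanti : ∀ i j, i ≤ j → S j ⊆ S i := fun i j h =>
    Set.preimage_mono (chainSet_antitone (G.pref 0) h)
  have two : ∀ i : Fin 2, i ≠ 0 → i = 1 := by decide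
  have hw : ∀ w j, Winning G.d (win w j) (fun u => s w j (u.drop w.length)) w
      (side (win w j) (S j)) := fun w j => by
    refine Winning.shift ?_
    rw [preimage_side]
    exact winning_of_isNash (hwin w j) (hs w j)
  have w0 : ∀ w j, win w j = 0 → Winning G.d 0 (fun u => s w j (u.drop w.length)) w (S j) :=
    fun w j h => by simpa [h, side] using hw w j
  have w1 : ∀ w j, win w j = 1 → Winning G.d 1 (fun u => s w j (u.drop w.length)) w (S j)ᶜ :=
    fun w j h => by simpa [h, side] using hw w j
  have win0 : ∀ t w j, Winning G.d 0 t w (S j) → win w j = 0 := fun t w j ht => by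
    by_contra h
    exact ht.not_compl (w1 w j (two _ h))
  have win1 : ∀ t w j, Winning G.d 1 t w (S j)ᶜ → win w j = 1 := fun t w j ht => by
    refine two _ fun h => (w0 w j h).not_compl ht
  -- The extreme thresholds are trivial: everything at 0, nothing at `k`. Hence the value is below
  -- `k`, and the threshold just above it is still covered by the search up to `k`.
  have hzero : ∀ w, win w 0 = 0 := fun w => win0 (fun _ => true) w 0 fun _ _ _ => trivial
  have hSk : S k = ∅ := by simp [hS, chainSet_card hwf]
  have hone : ∀ w, win w k = 1 := fun w => win1 (fun _ => true) w k fun x _ _ => by simp [hSk]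
  have vle : ∀ w, val w ≤ k := fun w => Nat.findGreatest_le k
  have v0 : ∀ w, win w (val w) = 0 := fun w =>
    Nat.findGreatest_spec (P := fun j => win w j = 0) (Nat.zero_le k) (hzero w)
  have vlt : ∀ w, val w < k := fun w => (vle w).lt_of_ne fun h => by
    have h1 := v0 w
    rw [h, hone w] at h1
    exact absurd h1 (by decide)
  have v1 : ∀ w, win w (val w + 1) = 1 := fun w => two _
    (Nat.findGreatest_is_greatest (P := fun j => win w j = 0) (Nat.lt_succ_self _) (vlt w))
  refine isSubgamePerfect_of_winning hG (U := chainSet (G.pref 0)) (val := val)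
    (fun j x y hx hr => ⟨x, hx, hr⟩) (fun l => ?_) fun l => ?_
  · refine winning_of_anchor (T := S) (μ := id) (k := k)
      -- The summand is the index of the player: player 0 plays for the value itself, player 1
      -- against the next threshold. Written this way it matches `combined` definitionally.
      (s := fun r u => s r (val r + 0) (u.drop r.length)) vle (fun _ _ h => h)
      (fun w w' h => hSanti _ _ h) (fun t l l' ht => ?_) (fun r => w0 r _ (v0 r))
      (fun w h => ?_) l
    · exact Nat.le_findGreatest (vle l') (win0 t l _ ht)
    · simp only [combined, h]
      rfl
  -- For player 1 smaller values are better, hence the reversed rating. Truncated subtraction is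
  -- harmless, as all values are at most `k`.
  · refine winning_of_anchor (T := fun v => (S (v + 1))ᶜ) (μ := fun v => k - v) (k := k)
      (s := fun r u => s r (val r + 1) (u.drop r.length)) (fun w => Nat.sub_le _ _)
      (fun w w' h => ?_) (fun w w' h => ?_) (fun t l l' ht => ?_)
      (fun r => w1 r _ (v1 r)) (fun w h => ?_) l
    · have := vle w
      have := vle w'
      omega
    · have := vle w
      have := vle w'
      exact Set.compl_subset_compl.2 (hSanti _ _ (by omega))
    -- If the value at `l'` were smaller, player 1 could exclude at `l` the threshold `val l`, which
    -- player 0 can enforce there.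
    · have : val l ≤ val l' := by
        by_contra hlt
        have h2 : win l (val l) = 1 :=
          win1 t l _ (ht.mono (Set.compl_subset_compl.2 (hSanti _ _ (by omega))))
        rw [v0] at h2
        exact absurd h2 (by decide)
      show k - val l' ≤ k - val l
      omega
    · simp only [combined, h]
      rfl

end Weih

/-! ### The reduction -/

namespace Weih

open Encodable

namespace OracleComp

variable {α β γ δ : Type} [Primcodable α] [Primcodable β] [Primcodable γ] [Primcodable δ]
  {D : Set Baire}

theorem ite_eq [DecidableEq β] {f g : Baire → α → β} {s t : Baire → α → γ}
    (hf : OracleComp D f) (hg : OracleComp D g) (hs : OracleComp D s) (ht : OracleComp D t) :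
    OracleComp D fun p a => if f p a = g p a then s p a else t p a := by
  have h : Primrec fun x : (β × β) × γ × γ => if x.1.1 = x.1.2 then x.2.1 else x.2.2 :=
    Primrec.ite (Primrec.eq.comp (Primrec.fst.comp Primrec.fst) (Primrec.snd.comp Primrec.fst))
      (Primrec.fst.comp Primrec.snd) (Primrec.snd.comp Primrec.snd)
  exact map h ((hf.mk hg).mk (hs.mk ht))

theorem natPair {f g : Baire → α → ℕ} (hf : OracleComp D f) (hg : OracleComp D g) :
    OracleComp D fun p a => Nat.pair (f p a) (g p a) :=
  map₂ Primrec₂.natPair hf hg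

theorem range_any {f : Baire → α → ℕ} {c : Baire → α × ℕ → Bool} (hf : OracleComp D f)
    (hc : OracleComp D c) : OracleComp D fun p a => (List.range (f p a)).any fun n => c p (a, n) := by
  have h : Primrec fun l : List Bool => l.any fun b => b :=
    (Primrec.list_foldr Primrec.id (Primrec.const false)
      ((Primrec.or.comp (Primrec.fst.comp Primrec.snd) (Primrec.snd.comp Primrec.snd)).to₂)).of_eq
      fun l => by induction l <;> simp_all
  refine (map h (hf.range_map hc)).congr fun p _ a => ?_
  rw [List.any_map]
  rfl

theorem pairing {f g : Baire → α → Baire} (hf : OracleComp D fun p (a : α × ℕ) => f p a.1 a.2)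
    (hg : OracleComp D fun p (a : α × ℕ) => g p a.1 a.2) :
    OracleComp D fun p (a : α × ℕ) => pair (f p a.1) (g p a.1) a.2 := by
  have hd : OracleComp D fun _ (a : α × ℕ) => (a.1, a.2.div2) :=
    fst.mk (map Primrec.nat_div2 snd)
  have hb : OracleComp D fun _ (a : α × ℕ) => a.2.bodd := map Primrec.nat_bodd snd
  refine (ite_eq hb (const true) (hg.comp hd) (hf.comp hd)).congr fun p _ a => ?_
  unfold pair
  cases a.2.bodd <;> rfl

theorem natName {f : Baire → α → ℕ} (hf : OracleComp D f) :
    OracleComp D fun p (a : α × ℕ) => natName (f p a.1) a.2 :=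
  ite_eq snd (hf.comp fst) (const 1) (const 0)

theorem section_section {f : Baire → α → ℕ} (i : ℕ) (hf : OracleComp D f) :
    OracleComp D fun p (a : α × ℕ) => sect (sect p i) (f p a.1) a.2 :=
  query (natPair (const i) (natPair (hf.comp fst) snd))

theorem joining {f : Baire → ℕ → Baire} (hf : OracleComp D fun p (a : ℕ × ℕ) => f p a.1 a.2) :
    OracleComp D fun p n => join (f p) n :=
  hf.comp (of_primrec Primrec.unpair)

/-- Application of a computable multivalued function to computed names. -/
theorem realize {X Y : RepSpace} {f : MultiFun X Y} (hf : f.IsComputable)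
    {N : Baire → α → Baire} (hN : OracleComp D fun p (a : α × ℕ) => N p a.1 a.2)
    (hdom : ∀ p ∈ D, ∀ a, ∃ x ∈ f.dom, X.names (N p a) x) :
    ∃ B : Baire → α → Baire, OracleComp D (fun p (a : α × ℕ) => B p a.1 a.2) ∧
      ∀ p ∈ D, ∀ a x, X.names (N p a) x → x ∈ f.dom → ∃ y ∈ f.val x, Y.names (B p a) y := by
  obtain ⟨F, ⟨Φ, hΦ, hF⟩, hreal⟩ := hf
  -- `B` must be total; its value off `D` is arbitrary.
  have h : ∀ p a, ∃ q, p ∈ D → q ∈ F (N p a) := fun p a => by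
    by_cases hp : p ∈ D
    · obtain ⟨x, hx, hn⟩ := hdom p hp a
      obtain ⟨q, hq, _⟩ := hreal _ x hn hx
      exact ⟨q, fun _ => hq⟩
    · exact ⟨0, fun h => absurd h hp⟩
  choose B hB using h
  refine ⟨B, apply hΦ hN fun p hp a n => hF _ _ (hB p a hp) n, fun p hp a x hn hx => ?_⟩
  obtain ⟨q, hq, y, hy, hqy⟩ := hreal _ x hn hx
  rw [Part.mem_unique (hB p a hp) hq]
  exact ⟨y, hy, hqy⟩

end OracleComp

/-! ### Names of the threshold games -/

theorem names_pair {X Y : RepSpace} {p q : Baire} {x : X.carrier} {y : Y.carrier}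
    (hx : X.names p x) (hy : Y.names q y) : (prodSpace X Y).names (pair p q) (x, y) :=
  ⟨(fstB_pair p q).symm ▸ hx, (sndB_pair p q).symm ▸ hy⟩

theorem names_natName {Y : Type} [Encodable Y] (y : Y) :
    (discreteSpace Y).names (natName (encode y)) y :=
  rfl

/-- Brings the winning set of a subgame within reach of the closure properties: intersect with a
cylinder, then undo the rescaling. -/
theorem rescale_preimage (w : List Bool) (S : Set Cantor) :
    rescale w (prepend w ⁻¹' S) = S ∩ clopenOf [w] := by
  ext y
  constructor
  · rintro ⟨x, hx, rfl⟩
    exact ⟨hx, w, by simp, x, rfl⟩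
  · rintro ⟨hy, v, hv, x, rfl⟩
    obtain rfl : v = w := by simpa using hv
    exact ⟨x, hy, rfl⟩

/-- `rescalingInv` specifies its result only through the rescaled set; injectivity identifies the
result itself. -/
theorem rescale_injective (w : List Bool) : Function.Injective (rescale w) := by
  intro S T h
  have key : ∀ S : Set Cantor, prepend w ⁻¹' rescale w S = S := fun S => by
    ext x
    constructor
    · rintro ⟨y, hy, e⟩
      rwa [prepend_injective w e]
    · exact fun hx => ⟨x, hx, rfl⟩
  rw [← key S, h, key T]

/-- The names of antagonistic games. -/
def gameNames (Γ : RepPointclass) : Set Baire := {p | ∃ G : AntagonisticGame Γ, G.IsName p}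

/-- The characteristic word of the set of the outcomes that are the top of a chain of length `j`
with respect to the preference of player `0`, computed from a name of the game. -/
def chainWord (p : Baire) : ℕ → List Bool
  -- `Nat.pair 0 0` addresses the number of outcomes in the name, and `Nat.pair 2` the preference
  -- table; the inner `Nat.pair 0 (Nat.pair y x)` is the code of player 0 with `y` and `x`.
  | 0 => (List.range (p (Nat.pair 0 0))).map fun _ => true
  | j + 1 => (List.range (p (Nat.pair 0 0))).map fun x =>
      (List.range (p (Nat.pair 0 0))).any fun y =>
        (chainWord p j).getD y false &&
          decide (p (Nat.pair 2 (Nat.pair 0 (Nat.pair y x))) = 1)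

theorem oracleComp_chainWord {α : Type} [Primcodable α] {D : Set Baire} {f : Baire → α → ℕ}
    (hf : OracleComp D f) : OracleComp D fun p a => chainWord p (f p a) := by
  have hk : ∀ {β : Type} [Primcodable β], OracleComp D fun p (_ : β) => p (Nat.pair 0 0) :=
    OracleComp.query (OracleComp.const _)
  have h0 : OracleComp D fun p (_ : α) => (List.range (p (Nat.pair 0 0))).map fun _ => true :=
    hk.range_map (g := fun _ _ => true) (OracleComp.const true)
  have hc : OracleComp D fun p (x : ((α × ℕ × List Bool) × ℕ) × ℕ) =>
      x.1.1.2.2.getD x.2 false &&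
        decide (p (Nat.pair 2 (Nat.pair 0 (Nat.pair x.2 x.1.2))) = 1) := by
    refine OracleComp.map₂ Primrec.and (OracleComp.map₂ (Primrec.list_getD false)
      (OracleComp.of_primrec ?_) OracleComp.snd) ?_
    · exact Primrec.snd.comp (Primrec.snd.comp (Primrec.fst.comp Primrec.fst))
    · refine (OracleComp.ite_eq (OracleComp.query (OracleComp.natPair (OracleComp.const 2)
        (OracleComp.natPair (OracleComp.const 0) (OracleComp.natPair OracleComp.snd
          (OracleComp.snd.comp OracleComp.fst))))) (OracleComp.const 1) (OracleComp.const true)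
          (OracleComp.const false)).congr fun p _ a => ?_
      split_ifs with h
      · exact (decide_eq_true h).symm
      · exact (decide_eq_false h).symm
  refine (hf.nat_rec h0 (hk.range_map (hk.range_any hc))).congr fun p _ a => ?_
  generalize f p a = t
  induction t with
  | zero => rfl
  | succ t ih => simp only [chainWord, ← ih]

theorem getElem?_map_range {β : Type} (k : ℕ) (f : ℕ → β) (x : Fin k) :
    ((List.range k).map f)[x.val]? = some (f x) := by
  simp

theorem chainWord_spec {Γ : RepPointclass} {G : AntagonisticGame Γ} {p : Baire}
    (hp : G.IsName p) (j : ℕ) : (chainWord p j).length = G.numOutcomes ∧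
      wordSet G.numOutcomes (chainWord p j) = chainSet (G.game.pref 0) j := by
  have hk : p (Nat.pair 0 0) = G.numOutcomes := hp.num
  have hpref : ∀ x y : Fin G.numOutcomes,
      p (Nat.pair 2 (Nat.pair 0 (Nat.pair x y))) = 1 ↔ G.game.pref 0 x y := fun x y => by
    by_cases h : G.game.pref 0 x y
    · exact iff_of_true (hp.pref_pos 0 x y h) h
    · have h0 : p (Nat.pair 2 (Nat.pair 0 (Nat.pair x y))) = 0 := hp.pref_neg 0 x y h
      exact iff_of_false (by omega) h
  induction j with
  | zero =>
    refine ⟨by simp [chainWord, hk], Set.eq_univ_of_forall fun x => ?_⟩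
    simp only [chainWord, hk, wordSet]
    exact getElem?_map_range _ _ x
  | succ j ih =>
    obtain ⟨ih1, ih2⟩ := ih
    refine ⟨by simp [chainWord, hk], Set.ext fun x => ?_⟩
    simp only [chainWord, hk, wordSet, chainSet, ← ih2]
    refine (Eq.congr_left (getElem?_map_range _ _ x)).trans ?_
    simp only [Option.some.injEq, List.any_eq_true, List.mem_range, Bool.and_eq_true,
      decide_eq_true_eq]
    constructor
    · rintro ⟨y, hy, h1, h2⟩
      refine ⟨⟨y, hy⟩, ?_, (hpref ⟨y, hy⟩ x).1 h2⟩
      have hy' : y < (chainWord p j).length := ih1 ▸ hy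
      show (chainWord p j)[y]? = some true
      rw [List.getElem?_eq_getElem hy']
      rw [List.getD_eq_getElem _ _ hy'] at h1
      rw [h1]
    · rintro ⟨y, hy, h⟩
      have hy : (chainWord p j)[y.val]? = some true := hy
      exact ⟨y, y.2, by simp [List.getD, hy], (hpref y x).2 h⟩

/-- From a name of an antagonistic game, names of the threshold sets in its subgames can be
computed. -/
theorem exists_subgame_names {Γ : RepPointclass} (hΓ : Γ.IsDeterminedPointclass) :
    ∃ B : Baire → List Bool × ℕ → Baire,
      OracleComp (gameNames Γ) (fun p (a : (List Bool × ℕ) × ℕ) => B p a.1 a.2) ∧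
      ∀ p (G : AntagonisticGame Γ), G.IsName p → ∀ a : List Bool × ℕ,
        Γ.names (B p a) (prepend a.1 ⁻¹' (G.game.v ⁻¹' chainSet (G.game.pref 0) a.2)) := by
  have hN : ∀ p (G : AntagonisticGame Γ), G.IsName p → ∀ a : List Bool × ℕ,
      Γ.names (sect (sect p 3) (encode ((0 : Fin 2), chainWord p a.2)))
        (G.game.v ⁻¹' chainSet (G.game.pref 0) a.2) := fun p G hp a => by
    obtain ⟨h1, h2⟩ := chainWord_spec hp a.2
    rw [← h2]
    refine hp.upper 0 _ h1 ?_
    rw [h2]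
    exact isUpper_chainSet _ _
  have c0 : OracleComp (gameNames Γ) fun _ (a : List Bool × ℕ) => encode [a.1] :=
    OracleComp.map Primrec.encode (OracleComp.map₂ Primrec.list_cons OracleComp.fst
      (OracleComp.const []))
  have c0' : OracleComp (gameNames Γ) fun p (a : List Bool × ℕ) =>
      encode ((0 : Fin 2), chainWord p a.2) :=
    OracleComp.map Primrec.encode (OracleComp.mk (OracleComp.const 0)
      (oracleComp_chainWord OracleComp.snd))
  have c1 := OracleComp.pairing (f := fun _ (a : List Bool × ℕ) => natName (encode [a.1]))
    (g := fun p (a : List Bool × ℕ) => sect (sect p 3) (encode ((0 : Fin 2), chainWord p a.2)))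
    c0.natName (c0'.section_section 3)
  obtain ⟨B₁, hB₁, hB₁'⟩ := OracleComp.realize hΓ.clopenInter_computable
    (N := fun p (a : List Bool × ℕ) => pair (natName (encode [a.1]))
        (sect (sect p 3) (encode ((0 : Fin 2), chainWord p a.2)))) c1
    fun p ⟨G, hG⟩ a => ⟨([a.1], ⟨_, _, hN p G hG a⟩), trivial,
      names_pair (names_natName _) (hN p G hG a)⟩
  have hB₁'' : ∀ p (G : AntagonisticGame Γ), G.IsName p → ∀ a : List Bool × ℕ,
      Γ.names (B₁ p a)
        (rescale a.1 (prepend a.1 ⁻¹' (G.game.v ⁻¹' chainSet (G.game.pref 0) a.2))) :=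
    fun p G hG a => by
      obtain ⟨y, hy, hn⟩ := hB₁' p ⟨G, hG⟩ a ([a.1], ⟨_, _, hN p G hG a⟩)
        (names_pair (names_natName _) (hN p G hG a)) trivial
      rw [rescale_preimage]
      have hy : y.1 = _ := hy
      rw [← hy]
      exact hn
  have c2 : OracleComp (gameNames Γ) fun p (a : (List Bool × ℕ) × ℕ) =>
      pair (natName (encode a.1.1)) (B₁ p a.1) a.2 :=
    OracleComp.pairing (f := fun _ (a : List Bool × ℕ) => natName (encode a.1))
      (OracleComp.natName (f := fun _ (a : List Bool × ℕ) => encode a.1)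
        (OracleComp.map Primrec.encode OracleComp.fst)) hB₁
  obtain ⟨B₂, hB₂, hB₂'⟩ := OracleComp.realize hΓ.rescalingInv_computable
    (N := fun p (a : List Bool × ℕ) => pair (natName (encode a.1)) (B₁ p a)) c2
    fun p ⟨G, hG⟩ a => ⟨(a.1, ⟨_, _, hB₁'' p G hG a⟩), ⟨_, rfl⟩,
      names_pair (names_natName _) (hB₁'' p G hG a)⟩
  refine ⟨B₂, hB₂, fun p G hG a => ?_⟩
  obtain ⟨y, hy, hn⟩ := hB₂' p ⟨G, hG⟩ a (a.1, ⟨_, _, hB₁'' p G hG a⟩)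
    (names_pair (names_natName _) (hB₁'' p G hG a)) ⟨_, rfl⟩
  have hy : rescale a.1 _ = rescale a.1 y.1 := hy
  rw [rescale_injective _ hy]
  exact hn

/-- The history and the threshold with index `m`. -/
def queryAt (m : ℕ) : List Bool × ℕ := (decode m).getD ([], 0)

theorem queryAt_encode (a : List Bool × ℕ) : queryAt (encode a) = a := by simp [queryAt]

theorem primrec_queryAt : Primrec queryAt :=
  Primrec.option_getD.comp Primrec.decode (Primrec.const _)

/-- The history with index `n`. -/
def historyAt (n : ℕ) : List Bool := (decode n).getD []

theorem historyAt_encode (w : List Bool) : historyAt (encode w) = w := by simp [historyAt]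

theorem primrec_historyAt : Primrec historyAt :=
  Primrec.option_getD.comp Primrec.decode (Primrec.const _)

/-- The win/lose game in the subgame at `w` in which player `0` aims at a chain of length `j`. -/
def thresholdGame {Γ : RepPointclass} (G : AntagonisticGame Γ)
    (hm : ∀ a : List Bool × ℕ,
      Γ.Mem (prepend a.1 ⁻¹' (G.game.v ⁻¹' chainSet (G.game.pref 0) a.2)))
    (a : List Bool × ℕ) : (winLoseSpace Γ).carrier :=
  (fun u => G.game.d (a.1 ++ u), ⟨_, hm a⟩)

/-- From a name of an antagonistic game, a name of the sequence of its threshold games can be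
computed. -/
theorem exists_query_names {Γ : RepPointclass} (hΓ : Γ.IsDeterminedPointclass) :
    ∃ Q : Baire → Baire, OracleComp (gameNames Γ) (fun p n => Q p n) ∧
      ∀ p (G : AntagonisticGame Γ), G.IsName p → ∃ hm, (seqSpace (winLoseSpace Γ)).names (Q p)
        fun m => thresholdGame G hm (queryAt m) := by
  obtain ⟨B, hB, hB'⟩ := exists_subgame_names hΓ
  refine ⟨fun p => join fun m => pair
    -- The turn table of a subgame is the given one read at prolonged histories. The default in
    -- `queryAt` makes every index `m` a legitimate instance.
    (fun n => p (Nat.pair 1 (encode ((queryAt m).1 ++ historyAt n)))) (B p (queryAt m)),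
    OracleComp.joining (OracleComp.pairing
      (f := fun p m n => p (Nat.pair 1 (encode ((queryAt m).1 ++ historyAt n))))
      (g := fun p m => B p (queryAt m)) ?_ ?_), fun p G hG => ⟨fun a => ⟨_, hB' p G hG a⟩, ?_⟩⟩
  · exact OracleComp.query (OracleComp.natPair (OracleComp.const 1)
      (OracleComp.map Primrec.encode (OracleComp.map₂ Primrec.list_append
        (OracleComp.map (Primrec.fst.comp primrec_queryAt) OracleComp.fst)
        (OracleComp.map primrec_historyAt OracleComp.snd))))
  · exact hB.comp ((OracleComp.map primrec_queryAt OracleComp.fst).mk OracleComp.snd)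
  · intro m
    rw [sect_join]
    refine ⟨?_, ?_⟩
    · rw [fstB_pair]
      intro u
      dsimp only
      rw [historyAt_encode]
      exact hG.turn _
    · rw [sndB_pair]
      exact hB' p G hG _

/-! ### Evaluating the answers -/

section Evaluation

variable (r : Baire)

/-- Whether player `0` wins the threshold game `(w, j)`, read off from the answers of `Win`. -/
def winAt (w : List Bool) (j : ℕ) : ℕ := fstB (sndB r) (Nat.pair (encode (w, j)) 0)

/-- Whose turn it is at `w`, read off from the name of the game. -/
def turnAt (w : List Bool) : ℕ := fstB r (Nat.pair 1 (encode w))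

/-- The value of the subgame at `w`, computed from the answers of `Win`. -/
def valueAt (w : List Bool) : ℕ :=
  Nat.rec (motive := fun _ => ℕ) 0 (fun y b => if winAt r w (y + 1) = 1 then y + 1 else b)
    (fstB r (Nat.pair 0 0))

/-- The move of player `t` at the history `u` after `w`, read off from the answers of `Det`. -/
def moveAt (w : List Bool) (t : ℕ) (u : List Bool) : ℕ :=
  sndB (sndB r) (Nat.pair (encode (w, valueAt r w + t)) (encode u))

/-- The anchor of player `t`, computed from the answers of `Win` and `Det`. -/
def anchorAt (t : ℕ) (w : List Bool) (n : ℕ) : ℕ :=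
  Nat.rec (motive := fun _ => ℕ) 0 (fun y a =>
    -- Nested equality tests stand for the conjunction and the implication in `anchor`, so that
    -- `OracleComp.ite_eq` applies to each.
    if valueAt r (w.take (y + 1)) = valueAt r (w.take y) then
      if turnAt r (w.take y) = t then
        if w.take (y + 1) = w.take y ++
          [decide (moveAt r (w.take a) t ((w.take y).drop (w.take a).length) = 1)]
        then a else y + 1
      else a
    else y + 1) n

/-- The strategy profile that is computed from the answers of `Win` and `Det`. -/
def profileAt (w : List Bool) : ℕ :=
  moveAt r (w.take (anchorAt r (turnAt r w) w w.length)) (turnAt r w)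
    (w.drop (w.take (anchorAt r (turnAt r w) w w.length)).length)

end Evaluation

/-! ### Computability of the evaluation -/

namespace OracleComp

variable {α : Type} [Primcodable α] {D : Set Baire}

theorem query_fst {f : Baire → α → ℕ} (hf : OracleComp D f) :
    OracleComp D fun r a => fstB r (f r a) :=
  query (map₂ Primrec.nat_mul (const 2) hf)

theorem double_add_one {f : Baire → α → ℕ} (hf : OracleComp D f) :
    OracleComp D fun r a => 2 * f r a + 1 :=
  map Primrec.succ (map₂ Primrec.nat_mul (const 2) hf)

theorem winAt {w : Baire → α → List Bool} {j : Baire → α → ℕ} (hw : OracleComp D w)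
    (hj : OracleComp D j) : OracleComp D fun r a => winAt r (w r a) (j r a) :=
  query (double_add_one (map₂ Primrec.nat_mul (const 2)
    (natPair (map Primrec.encode (hw.mk hj)) (const 0))))

theorem turnAt {w : Baire → α → List Bool} (hw : OracleComp D w) :
    OracleComp D fun r a => turnAt r (w r a) :=
  query_fst (natPair (const 1) (map Primrec.encode hw))

theorem valueAt {w : Baire → α → List Bool} (hw : OracleComp D w) :
    OracleComp D fun r a => valueAt r (w r a) := by
  have hs : OracleComp D fun _ (x : α × ℕ × ℕ) => x.2.1 + 1 :=
    map Primrec.succ (fst.comp snd)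
  exact (query_fst (const (Nat.pair 0 0))).nat_rec (const 0)
    (h := fun r x => if Weih.winAt r (w r x.1) (x.2.1 + 1) = 1 then x.2.1 + 1 else x.2.2)
    (ite_eq ((hw.comp fst).winAt hs) (const 1) hs (snd.comp snd))

theorem moveAt {w u : Baire → α → List Bool} {t : Baire → α → ℕ} (hw : OracleComp D w)
    (ht : OracleComp D t) (hu : OracleComp D u) :
    OracleComp D fun r a => moveAt r (w r a) (t r a) (u r a) :=
  query (double_add_one (double_add_one (natPair
    (map Primrec.encode (hw.mk (map₂ Primrec.nat_add hw.valueAt ht))) (map Primrec.encode hu))))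

theorem take {w : Baire → α → List Bool} {n : Baire → α → ℕ} (hw : OracleComp D w)
    (hn : OracleComp D n) : OracleComp D fun r a => (w r a).take (n r a) :=
  map₂ Primrec.list_take hn hw

theorem drop_length {w v : Baire → α → List Bool} (hw : OracleComp D w) (hv : OracleComp D v) :
    OracleComp D fun r a => (w r a).drop (v r a).length :=
  map₂ Primrec.list_drop (map Primrec.list_length hv) hw

theorem anchorAt {t : Baire → α → ℕ} {w : Baire → α → List Bool} {n : Baire → α → ℕ}
    (ht : OracleComp D t) (hw : OracleComp D w) (hn : OracleComp D n) :
    OracleComp D fun r a => anchorAt r (t r a) (w r a) (n r a) := by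
  have hy : OracleComp D fun _ (x : α × ℕ × ℕ) => x.2.1 := fst.comp snd
  have hs : OracleComp D fun _ (x : α × ℕ × ℕ) => x.2.1 + 1 := map Primrec.succ hy
  have ha : OracleComp D fun _ (x : α × ℕ × ℕ) => x.2.2 := snd.comp snd
  have hw' := hw.comp (fst (β := ℕ × ℕ))
  have ht' := ht.comp (fst (β := ℕ × ℕ))
  have hdec : Primrec fun m : ℕ => decide (m = 1) :=
    (Primrec.eq.comp Primrec.id (Primrec.const 1)).decide
  have hmove := (hw'.take ha).moveAt ht' ((hw'.take hy).drop_length (hw'.take ha))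
  exact hn.nat_rec (const 0) (h := fun r x =>
    if Weih.valueAt r ((w r x.1).take (x.2.1 + 1)) = Weih.valueAt r ((w r x.1).take x.2.1) then
      if Weih.turnAt r ((w r x.1).take x.2.1) = t r x.1 then
        if (w r x.1).take (x.2.1 + 1) = (w r x.1).take x.2.1 ++
          [decide (Weih.moveAt r ((w r x.1).take x.2.2) (t r x.1)
            (((w r x.1).take x.2.1).drop ((w r x.1).take x.2.2).length) = 1)]
        then x.2.2 else x.2.1 + 1
      else x.2.2
    else x.2.1 + 1)
    (ite_eq (hw'.take hs).valueAt (hw'.take hy).valueAt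
      (ite_eq (hw'.take hy).turnAt ht'
        (ite_eq (hw'.take hs) (map₂ Primrec.list_concat (hw'.take hy) (map hdec hmove)) ha hs)
        ha)
      hs)

theorem profileAt {w : Baire → α → List Bool} (hw : OracleComp D w) :
    OracleComp D fun r a => profileAt r (w r a) := by
  have h := hw.take (hw.turnAt.anchorAt hw (map Primrec.list_length hw))
  exact h.moveAt hw.turnAt (hw.drop_length h)

end OracleComp

/-! ### The evaluation agrees with the glued profile -/

section Correctness

variable {r : Baire} {k : ℕ} {d : List Bool → Fin 2} {win : List Bool → ℕ → Fin 2}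
  {s : List Bool → ℕ → List Bool → Bool}

theorem valueAt_eq (hk : fstB r (Nat.pair 0 0) = k)
    (hwin : ∀ w j, winAt r w j = 1 ↔ win w j = 0) (w : List Bool) :
    valueAt r w = gameValue win k w := by
  unfold valueAt gameValue
  rw [hk]
  clear hk
  induction k with
  | zero => rfl
  | succ k ih => simp only [Nat.findGreatest_succ, ← ih, hwin]

theorem moveAt_eq (hk : fstB r (Nat.pair 0 0) = k)
    (hwin : ∀ w j, winAt r w j = 1 ↔ win w j = 0)
    (hs : ∀ w j u, sndB (sndB r) (Nat.pair (encode (w, j)) (encode u)) = encode (s w j u))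
    (w : List Bool) (t : ℕ) (u : List Bool) :
    moveAt r w t u = encode (s w (gameValue win k w + t) u) := by
  unfold moveAt
  rw [hs, valueAt_eq hk hwin]

theorem anchorAt_eq (hk : fstB r (Nat.pair 0 0) = k) (hd : ∀ w, turnAt r w = (d w).val)
    (hwin : ∀ w j, winAt r w j = 1 ↔ win w j = 0)
    (hs : ∀ w j u, sndB (sndB r) (Nat.pair (encode (w, j)) (encode u)) = encode (s w j u))
    (i : Fin 2) (w : List Bool) (n : ℕ) :
    anchorAt r i.val w n = anchor d (gameValue win k)
      (fun v u => s v (gameValue win k v + i.val) (u.drop v.length)) i w n := by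
  induction n with
  | zero => rfl
  | succ n ih =>
    have hb : ∀ b : Bool, decide (encode b = 1) = b := by decide
    have h : anchorAt r i.val w (n + 1) =
      if valueAt r (w.take (n + 1)) = valueAt r (w.take n) then
        if turnAt r (w.take n) = i.val then
          if w.take (n + 1) = w.take n ++ [decide (moveAt r (w.take (anchorAt r i.val w n)) i.val
            ((w.take n).drop (w.take (anchorAt r i.val w n)).length) = 1)]
          then anchorAt r i.val w n else n + 1
        else anchorAt r i.val w n
      else n + 1 := rfl
    rw [h, anchor, ih, valueAt_eq hk hwin, valueAt_eq hk hwin, moveAt_eq hk hwin hs, hd, hb]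
    simp only [← Fin.ext_iff]
    split_ifs <;> first | rfl | (exfalso; tauto)

theorem profileAt_eq (hk : fstB r (Nat.pair 0 0) = k) (hd : ∀ w, turnAt r w = (d w).val)
    (hwin : ∀ w j, winAt r w j = 1 ↔ win w j = 0)
    (hs : ∀ w j u, sndB (sndB r) (Nat.pair (encode (w, j)) (encode u)) = encode (s w j u))
    (w : List Bool) : profileAt r w = encode (combined d (gameValue win k) s w) := by
  unfold profileAt combined
  rw [hd, anchorAt_eq hk hd hwin hs, moveAt_eq hk hwin hs]

end Correctness

end Weih

/-! ### The Weihrauch reduction -/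

theorem theorem23 (Γ : Weih.RepPointclass) (hΓ : Γ.IsDeterminedPointclass) :
    Weih.WeihrauchReducible (Weih.SPE Γ)
      ((Weih.Win Γ).parallel.prod (Weih.Det Γ).parallel) := by
  open Weih Encodable in
  obtain ⟨Q, hQ, hQ'⟩ := exists_query_names hΓ
  have hK : OracleComp Set.univ fun r n => profileAt r (historyAt n) :=
    OracleComp.profileAt (OracleComp.of_primrec primrec_historyAt)
  -- `Win` and `Det` receive the same sequence of games, so both halves of the query coincide and
  -- position `n` holds entry `n.div2` of `Q p`.
  have hH : OracleComp (gameNames Γ) fun p n => pair (Q p) (Q p) n :=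
    (hQ.comp (OracleComp.of_primrec Primrec.nat_div2)).congr fun p _ n => by
      unfold pair
      cases n.bodd <;> rfl
  refine ⟨restrict Set.univ fun r n => profileAt r (historyAt n),
    restrict (gameNames Γ) fun p => pair (Q p) (Q p), hK.computableFun, hH.computableFun,
    fun F hF p G hG _ => ?_⟩
  have hG : G.IsName p := hG
  obtain ⟨hm, hq⟩ := hQ' p G hG
  obtain ⟨q, hqF, y, hy, hqy⟩ := hF (pair (Q p) (Q p))
    (fun m => thresholdGame G hm (queryAt m), fun m => thresholdGame G hm (queryAt m))
    (names_pair hq hq) ⟨fun _ => trivial, fun _ => trivial⟩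
  obtain ⟨y₁, y₂⟩ := y
  obtain ⟨hy₁, hy₂⟩ := hy
  obtain ⟨hq₁, hq₂⟩ := hqy
  let win : List Bool → ℕ → Fin 2 := fun w j => y₁ (encode (w, j))
  let s : List Bool → ℕ → List Bool → Bool := fun w j => y₂ (encode (w, j))
  have hwin : ∀ w j, winAt (pair p q) w j = 1 ↔ win w j = 0 := fun w j => by
    have h : sect (fstB q) (encode (w, j)) = natName (encode (win w j)) := hq₁ (encode (w, j))
    have h0 : winAt (pair p q) w j = sect (fstB q) (encode (w, j)) 0 := by
      unfold winAt
      rw [sndB_pair]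
      rfl
    rw [h0, h]
    -- The name of `i` has its only 1 at position `i`, so entry 0 alone tells whether player 0 wins.
    have : ∀ i : Fin 2, natName (encode i) 0 = 1 ↔ i = 0 := by decide
    exact this _
  have hs : ∀ w j u, sndB (sndB (pair p q)) (Nat.pair (encode (w, j)) (encode u)) =
      encode (s w j u) := fun w j u => by
    rw [sndB_pair]
    exact hq₂ (encode (w, j)) u
  have hk : fstB (pair p q) (Nat.pair 0 0) = G.numOutcomes := by
    rw [fstB_pair]
    exact hG.num
  have hd : ∀ w, turnAt (pair p q) w = (G.game.d w).val := fun w => by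
    unfold turnAt
    rw [fstB_pair]
    exact hG.turn w
  refine ⟨fun n => profileAt (pair p q) (historyAt n), ?_,
    combined G.game.d (gameValue win G.numOutcomes) s, ?_, fun w => ?_⟩
  · simp only [Part.bind_eq_bind, Part.mem_bind_iff]
    exact ⟨_, mem_restrict.2 ⟨⟨G, hG⟩, rfl⟩, q, hqF, mem_restrict.2 ⟨trivial, rfl⟩⟩
  · refine isSubgamePerfect_combined G.antagonistic (G.wellFounded 0) (fun w j => ?_) fun w j => ?_
    · have h : HasWinningStrategy (thresholdGame G hm (queryAt (encode (w, j)))).1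
        (thresholdGame G hm (queryAt (encode (w, j)))).2.1 (win w j) := hy₁ (encode (w, j))
      rw [queryAt_encode] at h
      exact h
    · have h : (winLose (thresholdGame G hm (queryAt (encode (w, j)))).1
        (thresholdGame G hm (queryAt (encode (w, j)))).2.1).IsNash (s w j) := hy₂ (encode (w, j))
      rw [queryAt_encode] at h
      exact h
  · dsimp only
    rw [historyAt_encode]
    exact profileAt_eq hk hd hwin hs w
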